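/- Let $K$ be a field of characteristic different from $2$ and let $(\mathcal A,A,A')$ be a quasi-twilled associative algebra over $K$: $\mathcal A$ is an associative (not necessarily unital) $K$-algebra, $\mathcal A=A\oplus A'$ as vector spaces, and $A'$ is a subalgebra. Write the multiplication of $\mathcal A$ as $$(x,u)\cdot(y,v)=\bigl(\pi(x,y)+\xi(x,v)+\eta(u,y),\ \beta(u,v)+\rho(x,v)+\mu(u,y)+\theta(x,y)\bigr),\qquad x,y\in A,\ u,v\in A',$$ with bilinear maps $\pi:A\otimes A\to A$, $\xi:A\otimes A'\to A$, $\eta:A'\otimes A\to A$, $\beta:A'\otimes A'\to A'$, $\rho:A\otimes A'\to A'$, $\mu:A'\otimes A\to A'$, $\theta:A\otimes A\to A'$. A right deformation map is a linear map $D:A\to A'$ such that for all $x,y\in A$ $$D\bigl(\pi(x,y)+\xi(x,Dy)+\eta(Dx,y)\bigr)=\rho(x,Dy)+\mu(Dx,y)+\beta(Dx,Dy)+\theta(x,y).$$ On $\bigoplus_{n\ge0}\mathrm{Hom}(\otimes^{n+1}\mathcal A,\mathcal A)$, where $\mathrm{Hom}(\otimes^{n+1}\mathcal A,\mathcal A)$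 has degree $n$, let $[f,g]_G=f\circ g-(-1)^{mn}g\circ f$ be the Gerstenhaber bracket ($f$ of degree $m$, $g$ of degree $n$), where $$(f\circ g)(x_1,\dots,x_{m+n+1})=\sum_{i=1}^{m+1}(-1)^{(i-1)n}f(x_1,\dots,x_{i-1},g(x_i,\dots,x_{i+n}),x_{i+n+1},\dots,x_{m+n+1}).$$ Multilinear maps on tensor products of copies of $A$ and $A'$ with values in $A$ or $A'$ are regarded as elements of this space, extended by zero on the other summands of $\otimes^{n+1}(A\oplus A')$. On $\mathfrak g=\bigoplus_{n\ge0}\mathrm{Hom}(\otimes^{n+1}A,A')$, graded by $n$, put $$l_0=\theta,\qquad l_1(f)=[\pi+\rho+\mu,f]_G,\qquad l_2(f,g)=[[\xi+\eta+\beta,f]_G,g]_G,\qquad l_k=0\ (k\ge3).$$ For $x\in\mathfrak g$ of degree $0$ the operations twisted by $x$ are $l_k^x(x_1,\dots,x_k)=\sum_{n\ge0}\frac1{n!}l_{n+k}(x,\dots,x,x_1,\dots,x_k)$ for $k\ge1$. Here an $L_\infty$-algebra consists of graded symmetric operations $l_k$ $(k\ge1)$ of degree $1$ on a $\mathbb Z$-graded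 vector space satisfying the generalized Jacobi identities $\sum_{i}\sum_{\sigma\in S(i,n-i)}\varepsilon(\sigma)\,l_{n-i+1}(l_i(x_{\sigma(1)},\dots,x_{\sigma(i)}),x_{\sigma(i+1)},\dots,x_{\sigma(n)})=0$, where $S(i,n-i)$ is the set of $(i,n-i)$-shuffles and $\varepsilon(\sigma)$ is the Koszul sign; a Maurer–Cartan element of it is a degree $0$ element $x$ with $\sum_{k\ge1}\frac1{k!}l_k(x,\dots,x)=0$. \textbf{Theorem.} Let $D:A\to A'$ be a right deformation map of $(\mathcal A,A,A')$. Then $(\mathfrak g,\{l_k^D\}_{k\ge1})$ is an $L_\infty$-algebra, with $l_1^D(f)=l_1(f)+l_2(D,f)$, $l_2^D=l_2$ and $l_k^D=0$ for $k\ge3$; and for every linear map $D':A\to A'$, the map $D+D'$ is a right deformation map of $(\mathcal A,A,A')$ if and only if $D'$ is a Maurer–Cartan element of the $L_\infty$-algebra $(\mathfrak g,l_1^D,l_2^D)$. -/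

import Mathlib

open scoped DirectSum

set_option maxSynthPendingDepth 3

noncomputable section

/-! ### Curved `L_∞`-algebras -/

section LInfinity

variable {K V : Type*} [Field K] [AddCommGroup V] [Module K V]

/-- The Koszul sign `ε(σ; x₁, …, xₙ)` of a permutation of homogeneous elements with `|xᵢ| = d i`:
one factor `(-1)^{|x_{σ p}| |x_{σ q}|}` for every inversion `p < q`, `σ q < σ p`. -/
def koszulSign {n : ℕ} (d : Fin n → ℤ) (σ : Equiv.Perm (Fin n)) : ℤˣ :=
  ∏ p ∈ Finset.univ.filter (fun p : Fin n × Fin n => p.1 < p.2 ∧ σ p.2 < σ p.1),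
    Int.negOnePow (d (σ p.1) * d (σ p.2))

/-- `σ` is an `(i, n - i)`-shuffle: increasing on the first `i` and on the last `n - i` places. -/
def IsShuffle {n : ℕ} (i : ℕ) (σ : Equiv.Perm (Fin n)) : Prop :=
  (∀ a b : Fin n, a < b → (b : ℕ) < i → σ a < σ b) ∧
    (∀ a b : Fin n, a < b → i ≤ (a : ℕ) → σ a < σ b)

open scoped Classical in
/-- A curved `L_∞`-algebra (in the convention in which all `l_k` are graded symmetric of degree
`1`) on the `ℤ`-graded vector space `V = ⨁ i, 𝒢 i`. -/
structure IsCurvedLInfinityAlgebra (𝒢 : ℤ → Submodule K V)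
    (l : ∀ k : ℕ, MultilinearMap K (fun _ : Fin k => V) V) : Prop where
  /-- `V` is the direct sum of its homogeneous parts. -/
  isInternal : DirectSum.IsInternal 𝒢
  /-- every `l_k` has degree `1`. -/
  degree_one : ∀ (k : ℕ) (d : Fin k → ℤ) (x : Fin k → V), (∀ i, x i ∈ 𝒢 (d i)) →
    l k x ∈ 𝒢 (∑ i, d i + 1)
  /-- graded symmetry. -/
  graded_symm : ∀ (n : ℕ) (d : Fin n → ℤ) (x : Fin n → V), (∀ i, x i ∈ 𝒢 (d i)) →
    ∀ σ : Equiv.Perm (Fin n), l n (fun a => x (σ a)) = koszulSign d σ • l n x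
  /-- generalized Jacobi identity. -/
  jacobi : ∀ (n : ℕ) (d : Fin n → ℤ) (x : Fin n → V), (∀ i, x i ∈ 𝒢 (d i)) →
    ∑ i : Fin (n + 1), ∑ σ ∈ Finset.univ.filter (fun σ : Equiv.Perm (Fin n) => IsShuffle i σ),
      koszulSign d σ •
        l (n - i + 1)
          (Fin.cons (l i (fun a : Fin i => x (σ ⟨a, by omega⟩)))
            (fun b : Fin (n - i) => x (σ ⟨i + b, by omega⟩))) = 0

/-- An `L_∞`-algebra is a curved `L_∞`-algebra with `l₀ = 0`. -/
structure IsLInfinityAlgebra (𝒢 : ℤ → Submodule K V)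
    (l : ∀ k : ℕ, MultilinearMap K (fun _ : Fin k => V) V) : Prop
    extends IsCurvedLInfinityAlgebra 𝒢 l where
  l_zero : l 0 = 0

/-- A Maurer–Cartan element: a degree `0` element `x` with `∑_{k ≥ 0} (1 / k!) l_k(x, …, x) = 0`,
where only finitely many terms are nonzero. -/
def IsMaurerCartan (𝒢 : ℤ → Submodule K V)
    (l : ∀ k : ℕ, MultilinearMap K (fun _ : Fin k => V) V) (x : V) : Prop :=
  x ∈ 𝒢 0 ∧ {k : ℕ | l k (fun _ => x) ≠ 0}.Finite ∧
    ∑ᶠ k : ℕ, ((k.factorial : K)⁻¹) • l k (fun _ => x) = 0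

/-- The operations twisted by `x`:
`l_k^x(x₁, …, x_k) = ∑_{n ≥ 0} (1 / n!) l_{n+k}(x, …, x, x₁, …, x_k)` for `k ≥ 1`, and no `l₀`
(the sum is meant for families in which only finitely many `l_k` are nonzero). -/
def twist (l : ∀ k : ℕ, MultilinearMap K (fun _ : Fin k => V) V) (x : V) :
    ∀ k : ℕ, MultilinearMap K (fun _ : Fin k => V) V
  | 0 => 0
  | k + 1 => ∑ᶠ n : ℕ, ((n.factorial : K)⁻¹) •
      ((l (n + (k + 1))).domDomCongr finSumFinEquiv.symm).currySum (fun _ : Fin n => x)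

/-- A bilinear map, as a multilinear map in two variables. -/
def bilinToMultilinear {N : Type*} [AddCommGroup N] [Module K N] (B : V →ₗ[K] V →ₗ[K] N) :
    MultilinearMap K (fun _ : Fin 2 => V) N :=
  LinearMap.uncurryLeft
    (((MultilinearMap.ofSubsingletonₗ K K V N (0 : Fin 1)).toLinearMap).comp B)

end LInfinity

/-! ### Cochains and the Gerstenhaber bracket -/

section Cochains

variable (K V N : Type*) [Field K] [AddCommGroup V] [Module K V] [AddCommGroup N] [Module K N]

/-- `Hom(⊗^{n+1} V, N)`. -/
abbrev Cochain (n : ℕ) : Type _ := MultilinearMap K (fun _ : Fin (n + 1) => V) N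

/-- `⨁_{n ≥ 0} Hom(⊗^{n+1} V, N)`. -/
abbrev Cochains : Type _ := ⨁ n : ℕ, Cochain K V N n

/-- The grading in which the elements of `Hom(⊗^{n+1} V, N)` have degree `n`. -/
def cochainDegree (i : ℤ) : Submodule K (Cochains K V N) where
  carrier := {f | ∀ n : ℕ, (n : ℤ) ≠ i → f n = 0}
  add_mem' := by
    intro f g hf hg n hn
    simp [hf n hn, hg n hn]
  zero_mem' := by
    intro n _
    rfl
  smul_mem' := by
    intro c f hf n hn
    rw [DirectSum.smul_apply, hf n hn, smul_zero]

variable {K V N}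

/-- A cochain of degree `n` as an element of the direct sum. -/
abbrev cochainOf (n : ℕ) : Cochain K V N n →ₗ[K] Cochains K V N :=
  DirectSum.lof K ℕ (fun n => Cochain K V N n) n

/-- A linear map as a cochain (of degree `0`). -/
def linCochain (f : V →ₗ[K] N) : Cochains K V N :=
  cochainOf 0 (MultilinearMap.ofSubsingleton K V N (0 : Fin 1) f)

/-- A bilinear map as a cochain (of degree `1`). -/
def bilinCochain (B : V →ₗ[K] V →ₗ[K] N) : Cochains K V N :=
  cochainOf 1 (bilinToMultilinear B)

/-- The argument list `x₁, …, x_{i-1}, g(x_i, …, x_{i+n}), x_{i+n+1}, …` (here `i` counts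
from `0`). -/
def insertArg {m n : ℕ} (g : (Fin (n + 1) → V) → V) (i : Fin (m + 1))
    (x : Fin (m + n + 1) → V) (j : Fin (m + 1)) : V :=
  if j < i then x ⟨j, by omega⟩
  else if j = i then g (fun k => x ⟨i + k, by omega⟩)
  else x ⟨j + n, by omega⟩

theorem insertArg_update_fst {m n : ℕ} [DecidableEq (Fin (m + n + 1))]
    (g : (Fin (n + 1) → V) → V) (i : Fin (m + 1)) (x : Fin (m + n + 1) → V)
    (a : Fin (m + n + 1)) (v : V) (h : (a : ℕ) < i) :
    insertArg g i (Function.update x a v) =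
      Function.update (insertArg g i x) ⟨a, by omega⟩ v := by
  funext j
  simp only [insertArg, Function.update_apply, Fin.ext_iff, Fin.lt_def]
  have h1 : ∀ k : Fin (n + 1), ((i : ℕ) + k = a) = False := fun k => by
    simp only [eq_iff_iff, iff_false]; omega
  simp only [h1, if_false]
  split_ifs <;> first | rfl | omega

theorem insertArg_update_mid {m n : ℕ} [DecidableEq (Fin (m + n + 1))]
    (g : (Fin (n + 1) → V) → V) (i : Fin (m + 1)) (x : Fin (m + n + 1) → V)
    (a : Fin (m + n + 1)) (v : V) (h : (i : ℕ) ≤ a) (h' : (a : ℕ) ≤ i + n) :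
    insertArg g i (Function.update x a v) =
      Function.update (insertArg g i x) i
        (g (Function.update (fun k : Fin (n + 1) => x ⟨i + k, by omega⟩)
          ⟨a - i, by omega⟩ v)) := by
  funext j
  have h2 : (fun k : Fin (n + 1) => Function.update x a v ⟨i + k, by omega⟩) =
      Function.update (fun k : Fin (n + 1) => x ⟨i + k, by omega⟩) ⟨a - i, by omega⟩ v := by
    funext k
    simp only [Function.update_apply, Fin.ext_iff]
    split_ifs <;> first | rfl | omega
  simp only [insertArg, h2]
  simp only [insertArg, Function.update_apply, Fin.ext_iff, Fin.lt_def]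
  split_ifs <;> first | rfl | omega

theorem insertArg_update_snd {m n : ℕ} [DecidableEq (Fin (m + n + 1))]
    (g : (Fin (n + 1) → V) → V) (i : Fin (m + 1)) (x : Fin (m + n + 1) → V)
    (a : Fin (m + n + 1)) (v : V) (h : (i : ℕ) + n < a) :
    insertArg g i (Function.update x a v) =
      Function.update (insertArg g i x) ⟨a - n, by omega⟩ v := by
  funext j
  simp only [insertArg, Function.update_apply, Fin.ext_iff, Fin.lt_def]
  have h1 : ∀ k : Fin (n + 1), ((i : ℕ) + k = a) = False := fun k => by
    simp only [eq_iff_iff, iff_false]; omega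
  simp only [h1, if_false]
  split_ifs <;> first | rfl | omega

/-- The insertion of `g` into the `i`-th place of `f` (`i` counts from `0`):
`f(x₁, …, x_{i-1}, g(x_i, …, x_{i+n}), x_{i+n+1}, …, x_{m+n+1})`. -/
def insertion {m n : ℕ} (f : Cochain K V V m) (g : Cochain K V V n) (i : Fin (m + 1)) :
    Cochain K V V (m + n) where
  toFun x := f (insertArg g i x)
  map_update_add' := by
    intro _ x a v w
    rcases lt_or_ge (a : ℕ) i with h | h
    · simp only [insertArg_update_fst _ _ _ _ _ h, f.map_update_add]
    · rcases le_or_gt (a : ℕ) (i + n) with h' | h'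
      · simp only [insertArg_update_mid _ _ _ _ _ h h', g.map_update_add, f.map_update_add]
      · simp only [insertArg_update_snd _ _ _ _ _ h', f.map_update_add]
  map_update_smul' := by
    intro _ x a c v
    rcases lt_or_ge (a : ℕ) i with h | h
    · simp only [insertArg_update_fst _ _ _ _ _ h, f.map_update_smul]
    · rcases le_or_gt (a : ℕ) (i + n) with h' | h'
      · simp only [insertArg_update_mid _ _ _ _ _ h h', g.map_update_smul, f.map_update_smul]
      · simp only [insertArg_update_snd _ _ _ _ _ h', f.map_update_smul]

theorem insertion_apply {m n : ℕ} (f : Cochain K V V m) (g : Cochain K V V n) (i : Fin (m + 1))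
    (x : Fin (m + n + 1) → V) : insertion f g i x = f (insertArg g i x) := rfl

theorem insertArg_eq_update {m n : ℕ} (g : (Fin (n + 1) → V) → V) (i : Fin (m + 1))
    (x : Fin (m + n + 1) → V) :
    insertArg g i x = Function.update (insertArg (fun _ => 0) i x) i
      (g (fun k => x ⟨i + k, by omega⟩)) := by
  funext j
  by_cases h : j = i
  · subst h; simp [insertArg]
  · simp [insertArg, h]

/-- The insertion as a bilinear map in `f` and `g`. -/
def insertionₗ (m n : ℕ) (i : Fin (m + 1)) :
    Cochain K V V m →ₗ[K] Cochain K V V n →ₗ[K] Cochain K V V (m + n) :=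
  LinearMap.mk₂ K (fun f g => insertion f g i)
    (fun _ _ _ => rfl) (fun _ _ _ => rfl)
    (fun f g g' => by
      ext x
      simp only [insertion_apply, add_apply]
      rw [insertArg_eq_update (⇑(g + g')), insertArg_eq_update g, insertArg_eq_update g',
        add_apply, f.map_update_add])
    (fun c f g => by
      ext x
      simp only [insertion_apply, smul_apply]
      rw [insertArg_eq_update (⇑(c • g)), insertArg_eq_update g,
        smul_apply, f.map_update_smul])

/-- `f ∘ g = ∑_{i} (-1)^{(i-1)n} f(x₁, …, x_{i-1}, g(x_i, …, x_{i+n}), …)` for `f` of degree `m`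
and `g` of degree `n`; with `i` counted from `0` the sign is `(-1)^{i n}`. -/
def gerstenhaberComp (m n : ℕ) :
    Cochain K V V m →ₗ[K] Cochain K V V n →ₗ[K] Cochain K V V (m + n) :=
  ∑ i : Fin (m + 1), ((-1 : K) ^ ((i : ℕ) * n)) • insertionₗ m n i

/-- `[f, g]_G = f ∘ g - (-1)^{m n} g ∘ f` for `f` of degree `m` and `g` of degree `n`. -/
def gerstenhaberBracketHom (m n : ℕ) :
    Cochain K V V m →ₗ[K] Cochain K V V n →ₗ[K] Cochains K V V :=
  (gerstenhaberComp m n).compr₂ (cochainOf (m + n)) -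
    ((-1 : K) ^ (m * n)) • ((gerstenhaberComp n m).compr₂ (cochainOf (n + m))).flip

/-- The Gerstenhaber bracket `[·, ·]_G` on `⨁_{n ≥ 0} Hom(⊗^{n+1} V, V)`: the bilinear extension
of the bracket of homogeneous elements. -/
def gerstenhaberBracket : Cochains K V V →ₗ[K] Cochains K V V →ₗ[K] Cochains K V V :=
  DirectSum.toModule K ℕ _ fun m =>
    (DirectSum.toModule K ℕ _ fun n => (gerstenhaberBracketHom m n).flip).flip

end Cochains

/-! ### Quasi-twilled associative algebras and right deformation maps -/

/-- A decomposition `𝒜 = A ⊕ A'` of an associative (not necessarily unital) algebra `𝒜` into two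
subspaces such that `A'` is a subalgebra; `(𝒜, A, A')` is a quasi-twilled associative algebra. -/
structure QuasiTwilled (K 𝒜 : Type*) [Field K] [NonUnitalRing 𝒜] [Module K 𝒜]
    [SMulCommClass K 𝒜 𝒜] [IsScalarTower K 𝒜 𝒜] where
  /-- the complement `A` -/
  A : Submodule K 𝒜
  /-- the subalgebra `A'` -/
  A' : Submodule K 𝒜
  isCompl : IsCompl A A'
  mul_mem : ∀ u ∈ A', ∀ v ∈ A', u * v ∈ A'

namespace QuasiTwilled

variable {K 𝒜 : Type*} [Field K] [NonUnitalRing 𝒜] [Module K 𝒜]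
  [SMulCommClass K 𝒜 𝒜] [IsScalarTower K 𝒜 𝒜] (Q : QuasiTwilled K 𝒜)

/-- The projection `𝒜 → A` along `A'`. -/
def pr : 𝒜 →ₗ[K] Q.A := Q.A.projectionOnto Q.A' Q.isCompl

/-- The projection `𝒜 → A'` along `A`. -/
def pr' : 𝒜 →ₗ[K] Q.A' := Q.A'.projectionOnto Q.A Q.isCompl.symm

/-- The component `π : A ⊗ A → A` of the multiplication. -/
def π : Q.A →ₗ[K] Q.A →ₗ[K] Q.A :=
  ((LinearMap.mul K 𝒜).compl₁₂ Q.A.subtype Q.A.subtype).compr₂ Q.pr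

/-- The component `θ : A ⊗ A → A'`. -/
def θ : Q.A →ₗ[K] Q.A →ₗ[K] Q.A' :=
  ((LinearMap.mul K 𝒜).compl₁₂ Q.A.subtype Q.A.subtype).compr₂ Q.pr'

/-- The component `ξ : A ⊗ A' → A`. -/
def ξ : Q.A →ₗ[K] Q.A' →ₗ[K] Q.A :=
  ((LinearMap.mul K 𝒜).compl₁₂ Q.A.subtype Q.A'.subtype).compr₂ Q.pr

/-- The component `ρ : A ⊗ A' → A'`. -/
def ρ : Q.A →ₗ[K] Q.A' →ₗ[K] Q.A' :=
  ((LinearMap.mul K 𝒜).compl₁₂ Q.A.subtype Q.A'.subtype).compr₂ Q.pr'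

/-- The component `η : A' ⊗ A → A`. -/
def η : Q.A' →ₗ[K] Q.A →ₗ[K] Q.A :=
  ((LinearMap.mul K 𝒜).compl₁₂ Q.A'.subtype Q.A.subtype).compr₂ Q.pr

/-- The component `μ : A' ⊗ A → A'`. -/
def μ : Q.A' →ₗ[K] Q.A →ₗ[K] Q.A' :=
  ((LinearMap.mul K 𝒜).compl₁₂ Q.A'.subtype Q.A.subtype).compr₂ Q.pr'

/-- The component `β : A' ⊗ A' → A'`. -/
def β : Q.A' →ₗ[K] Q.A' →ₗ[K] Q.A' :=
  ((LinearMap.mul K 𝒜).compl₁₂ Q.A'.subtype Q.A'.subtype).compr₂ Q.pr'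

/-- A right deformation map of `(𝒜, A, A')`. -/
def IsRightDeformationMap (D : Q.A →ₗ[K] Q.A') : Prop :=
  ∀ x y : Q.A, D (Q.π x y + Q.ξ x (D y) + Q.η (D x) y) =
    Q.ρ x (D y) + Q.μ (D x) y + Q.β (D x) (D y) + Q.θ x y

/-! The lifts to `𝒜 = A ⊕ A'` of the components: they act by the component on the respective
summand of `𝒜 ⊗ 𝒜` and by zero on the others. -/

/-- The lift of `π + ρ + μ`, an element of `Hom(𝒜 ⊗ 𝒜, 𝒜)`. -/
def liftπρμ : 𝒜 →ₗ[K] 𝒜 →ₗ[K] 𝒜 :=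
  (Q.π.compl₁₂ Q.pr Q.pr).compr₂ Q.A.subtype +
    (Q.ρ.compl₁₂ Q.pr Q.pr').compr₂ Q.A'.subtype +
    (Q.μ.compl₁₂ Q.pr' Q.pr).compr₂ Q.A'.subtype

/-- The lift of `ξ + η + β`, an element of `Hom(𝒜 ⊗ 𝒜, 𝒜)`. -/
def liftξηβ : 𝒜 →ₗ[K] 𝒜 →ₗ[K] 𝒜 :=
  (Q.ξ.compl₁₂ Q.pr Q.pr').compr₂ Q.A.subtype +
    (Q.η.compl₁₂ Q.pr' Q.pr).compr₂ Q.A.subtype +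
    (Q.β.compl₁₂ Q.pr' Q.pr').compr₂ Q.A'.subtype

/-- The lift `⨁ Hom(⊗^{n+1} A, A') → ⨁ Hom(⊗^{n+1} 𝒜, 𝒜)`: a cochain acts on `⊗^{n+1} A` and by
zero on the other summands of `⊗^{n+1} 𝒜`. -/
def lift : Cochains K Q.A Q.A' →ₗ[K] Cochains K 𝒜 𝒜 :=
  DirectSum.lmap fun n =>
    (Q.A'.subtype.compMultilinearMapₗ K).comp
      (MultilinearMap.compLinearMapₗ (fun _ : Fin (n + 1) => Q.pr))

/-- The projection `P` of `⨁ Hom(⊗^{n+1} 𝒜, 𝒜)` onto the subspace `⨁ Hom(⊗^{n+1} A, A')`. -/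
def proj : Cochains K 𝒜 𝒜 →ₗ[K] Cochains K Q.A Q.A' :=
  DirectSum.lmap fun n =>
    (Q.pr'.compMultilinearMapₗ K).comp
      (MultilinearMap.compLinearMapₗ (fun _ : Fin (n + 1) => Q.A.subtype))

/-- `l₀ = θ`. -/
def l₀ : Cochains K Q.A Q.A' := bilinCochain Q.θ

/-- `l₁(f) = [π + ρ + μ, f]_G`; `proj` only regards this element of `⨁ Hom(⊗^{n+1} A, A')` as
such. -/
def l₁ : Cochains K Q.A Q.A' →ₗ[K] Cochains K Q.A Q.A' :=
  (Q.proj.comp (gerstenhaberBracket (bilinCochain Q.liftπρμ))).comp Q.lift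

/-- `l₂(f, g) = [[ξ + η + β, f]_G, g]_G`; `proj` only regards this element of
`⨁ Hom(⊗^{n+1} A, A')` as such. -/
def l₂ : Cochains K Q.A Q.A' →ₗ[K] Cochains K Q.A Q.A' →ₗ[K] Cochains K Q.A Q.A' :=
  (gerstenhaberBracket.compl₁₂
    ((gerstenhaberBracket (bilinCochain Q.liftξηβ)).comp Q.lift) Q.lift).compr₂ Q.proj

/-- The curved `L_∞`-structure `(l₀, l₁, l₂)`, `l_k = 0` for `k ≥ 3`, on
`⨁ Hom(⊗^{n+1} A, A')`. -/
def l : ∀ k : ℕ, MultilinearMap K (fun _ : Fin k => Cochains K Q.A Q.A') (Cochains K Q.A Q.A')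
  | 0 => MultilinearMap.constOfIsEmpty K _ Q.l₀
  | 1 => MultilinearMap.ofSubsingleton K _ _ (0 : Fin 1) Q.l₁
  | 2 => bilinToMultilinear Q.l₂
  | _ + 3 => 0

/-- The operations `l_k^D` of the `L_∞`-algebra twisted by `D : A → A'`. -/
def twisted (D : Q.A →ₗ[K] Q.A') :
    ∀ k : ℕ, MultilinearMap K (fun _ : Fin k => Cochains K Q.A Q.A') (Cochains K Q.A Q.A') :=
  twist Q.l (linCochain D)

end QuasiTwilled

end

/-! The structure is a derived-bracket construction inside the graded Lie algebra of cochains on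
`𝒜`, and all identities are proved there after applying the injective map `lift`. Write p for the
lift of π + ρ + μ, q for the lift of ξ + η + β, and t for the lift of θ.

The multiplication of `𝒜` is t + p + q, and associativity says that its Gerstenhaber square
vanishes. Put `A` in degree 0 and `A'` in degree 1, and say that a cochain has weight w if it lowers
total degree by w. Then t, p, q have weights -1, 0, 1, and brackets add weights. Separating the
square by weight yields [q,q] = 0, [p,q] = 0 and [p,p] + 2[q,t] = 0 (`bracket_relations`). The
lifted cochains are exactly those of weight -1. They bracket to zero, since nothing nonzero has
weight -2, and they are preserved by [p, ·] and by [[q, ·], ·].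

A map D is a right deformation map iff l₀ + l₁(D) + ½ l₂(D,D) = 0 (`isRightDeformationMap_iff`). The
twisted differential is the bracket with P = p + [q,D]. Always [P,q] = 0, and the equation for D
gives [P,P] = 0 (`twistedProduct_self`). The generalized Jacobi identities are then formal
consequences of the graded Lie axioms (`square_zero`, `derived_leibniz`, `derived_jacobi`).
Expanding the equation at D + D' and subtracting the one for D leaves the Maurer–Cartan equation of
D' for the twisted operations. -/

noncomputable section

/-! ### The Gerstenhaber bracket: pre-Lie identity, antisymmetry and Jacobi identity. -/

section Gerstenhaber

variable {K V N : Type*} [Field K] [AddCommGroup V] [Module K V] [AddCommGroup N] [Module K N]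

/-- Evaluation of the component of degree `n` at the first `n + 1` terms of a sequence. -/
def evalSeq (n : ℕ) (x : ℕ → V) : Cochains K V N →ₗ[K] N where
  toFun F := F n (fun k => x k)
  map_add' _ _ := rfl
  map_smul' _ _ := rfl

theorem evalSeq_apply (n : ℕ) (x : ℕ → V) (F : Cochains K V N) :
    evalSeq n x F = F n (fun k => x k) := rfl

theorem evalSeq_cochainOf (m n : ℕ) (f : Cochain K V N m) (x : ℕ → V) :
    evalSeq n x (cochainOf m f) = if m = n then f (fun k => x k) else 0 := by
  rw [evalSeq_apply, DirectSum.lof_eq_of]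
  split_ifs with h
  · subst h
    rw [DirectSum.of_eq_same]
  · rw [DirectSum.of_eq_of_ne _ _ _ (Ne.symm h)]
    rfl

theorem cochain_ext_seq {n : ℕ} {f g : Cochain K V N n}
    (h : ∀ x : ℕ → V, f (fun k => x k) = g (fun k => x k)) : f = g := by
  ext v
  have := h (fun k => if hk : k < n + 1 then v ⟨k, hk⟩ else 0)
  simpa only [Fin.is_lt, dite_true, Fin.eta] using this

/-- Sequences indexed by ℕ provide arguments for every arity at once, so cochains of degrees `m + n
+ p` and `m + (n + p)` can be compared without transport between types. -/
theorem cochains_ext_seq {F G : Cochains K V N} (h : ∀ n x, evalSeq n x F = evalSeq n x G) :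
    F = G :=
  DFinsupp.ext fun n => cochain_ext_seq fun x => h n x

/-- The sequence `x₀, …, x_{i-1}, g(x_i, …, x_{i+n}), x_{i+n+1}, …`. -/
def insertSeq {n : ℕ} (g : (Fin (n + 1) → V) → V) (i : ℕ) (x : ℕ → V) (j : ℕ) : V :=
  if j < i then x j else if j = i then g (fun k => x (i + k)) else x (j + n)

-- The two blocks are disjoint. Since `h` contracts `p + 1` entries to one, place `i` after its
-- insertion is place `i + p` of the original sequence.
omit [AddCommGroup V] in
theorem insertSeq_comm {n p : ℕ} (g : (Fin (n + 1) → V) → V) (h : (Fin (p + 1) → V) → V)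
    {i j : ℕ} (hij : j < i) (x : ℕ → V) :
    insertSeq g i (insertSeq h j x) = insertSeq h j (insertSeq g (i + p) x) := by
  have hh : (fun l : Fin (p + 1) => insertSeq g (i + p) x (j + l)) =
        fun l : Fin (p + 1) => x (j + l) := by
    funext l
    simp only [insertSeq, show j + (l : ℕ) < i + p by omega, if_true]
  have hg : (fun l : Fin (n + 1) => insertSeq h j x (i + l)) = fun l : Fin (n + 1) => x (i + p + l) := by
    funext l
    simp only [insertSeq, show ¬ i + (l : ℕ) < j by omega, show i + (l : ℕ) ≠ j by omega, if_false]
    congr 1; omega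
  funext k
  have e1 : ∀ (y : ℕ → V) k, insertSeq g i y k =
    if k < i then y k else if k = i then g (fun l => y (i + l)) else y (k + n) := fun _ _ => rfl
  have e2 : ∀ (y : ℕ → V) k, insertSeq h j y k =
    if k < j then y k else if k = j then h (fun l => y (j + l)) else y (k + p) := fun _ _ => rfl
  rw [e1, hg, e2, e2, e2, hh]
  simp only [insertSeq]
  split_ifs <;> first | omega | rfl | (congr 1; omega)

theorem insertSeq_nested {n p : ℕ} (g : Cochain K V V n) (h : Cochain K V V p)
    (i : ℕ) (j : Fin (n + 1)) (x : ℕ → V) :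
    insertSeq g i (insertSeq h (i + j) x) = insertSeq (insertion g h j) i x := by
  funext k
  rcases lt_trichotomy k i with hk | rfl | hk
  · simp [insertSeq, hk, show k < i + j by omega]
  · simp only [insertSeq, lt_irrefl, if_false, if_true, insertion_apply]
    congr 1
    funext l
    simp only [insertArg, Fin.lt_def, Fin.ext_iff, add_lt_add_iff_left, Nat.add_left_cancel_iff,
      add_assoc]
  · simp only [insertSeq, show ¬ k < i by omega, show k ≠ i by omega,
      show ¬ k + n < i + j by omega, show k + n ≠ i + j by omega, if_false]
    congr 1; omega

theorem insertion_seq {m n : ℕ} (f : Cochain K V V m) (g : Cochain K V V n) (i : Fin (m + 1))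
    (x : ℕ → V) :
    insertion f g i (fun k => x k) = f (fun k => insertSeq g i x k) := by
  rw [insertion_apply]
  congr 1
  funext k
  simp only [insertArg, insertSeq, Fin.lt_def, Fin.ext_iff]

theorem gerstenhaberComp_seq {m n : ℕ} (f : Cochain K V V m) (g : Cochain K V V n) (x : ℕ → V) :
    gerstenhaberComp m n f g (fun k => x k) =
      ∑ i ∈ Finset.range (m + 1), (-1 : K) ^ (i * n) • f (fun k => insertSeq g i x k) := by
  rw [← Fin.sum_univ_eq_sum_range
    (fun i => (-1 : K) ^ (i * n) • f (fun k => insertSeq g i x k))]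
  simp only [gerstenhaberComp, LinearMap.sum_apply, sum_apply, LinearMap.smul_apply,
    smul_apply]
  exact Finset.sum_congr rfl fun i _ => by rw [← insertion_seq]; rfl

theorem gerstenhaberComp_comp_seq {m n p : ℕ} (f : Cochain K V V m) (g : Cochain K V V n)
    (h : Cochain K V V p) (x : ℕ → V) :
    gerstenhaberComp m (n + p) f (gerstenhaberComp n p g h) (fun k => x k) =
      ∑ i ∈ Finset.range (m + 1), ∑ j ∈ Finset.range (n + 1),
        (-1 : K) ^ (i * n + (i + j) * p) •
          f (fun k => insertSeq g i (insertSeq h (i + j) x) k) := by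
  rw [← Fin.sum_univ_eq_sum_range (fun i => ∑ j ∈ Finset.range (n + 1),
        (-1 : K) ^ (i * n + (i + j) * p) •
          f (fun k => insertSeq g i (insertSeq h (i + j) x) k))]
  simp only [gerstenhaberComp, LinearMap.sum_apply, sum_apply, LinearMap.smul_apply,
    smul_apply, map_sum, map_smul, Finset.smul_sum]
  rw [Finset.sum_comm]
  refine Finset.sum_congr rfl fun i _ => ?_
  rw [← Fin.sum_univ_eq_sum_range (fun j => 
        (-1 : K) ^ (i * n + (i + j) * p) •
          f (fun k => insertSeq g i (insertSeq h (i + j) x) k))]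
  refine Finset.sum_congr rfl fun j _ => ?_
  rw [smul_smul, ← pow_add]
  simp only [insertSeq_nested]
  rw [← insertion_seq f (insertion g h j)]
  congr 2
  ring

/-- The terms of `(f ∘ g) ∘ h` in which `h` is inserted to the left of `g`. -/
def compLeft {m n p : ℕ} (f : Cochain K V V m) (g : Cochain K V V n)
    (h : Cochain K V V p) (x : ℕ → V) : V :=
  ∑ i ∈ Finset.range (m + 1), ∑ j ∈ Finset.range i,
    (-1 : K) ^ (i * n + j * p) • f (fun k => insertSeq g i (insertSeq h j x) k)

/-- In (f ∘ g) ∘ h, with `g` at place `i` of `f`, the place `j` of `h` lies left of the block of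
`g`, inside it, or right of it. The inside terms form f ∘ (g ∘ h). The right terms are left terms
with `g` and `h` exchanged, so the associator is visibly symmetric up to sign. -/
theorem gerstenhaberComp_assoc_seq {m n p : ℕ} (f : Cochain K V V m) (g : Cochain K V V n)
    (h : Cochain K V V p) (x : ℕ → V) :
    gerstenhaberComp (m + n) p (gerstenhaberComp m n f g) h (fun k => x k) =
      gerstenhaberComp m (n + p) f (gerstenhaberComp n p g h) (fun k => x k) +
        (compLeft f g h x + (-1 : K) ^ (n * p) • compLeft f h g x) := by
  rw [gerstenhaberComp_comp_seq, gerstenhaberComp_seq]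
  simp only [gerstenhaberComp_seq, Finset.smul_sum, smul_smul, ← pow_add]
  have hc : (-1 : K) ^ (n * p) • compLeft f h g x =
      ∑ i ∈ Finset.range (m + 1), ∑ j ∈ Finset.Ico (i + n + 1) (m + n + 1),
        (-1 : K) ^ (i * n + j * p) • f (fun k => insertSeq g i (insertSeq h j x) k) := by
    have h1 : ∀ i, ∑ j ∈ Finset.Ico (i + n + 1) (m + n + 1),
        (-1 : K) ^ (i * n + j * p) • f (fun k => insertSeq g i (insertSeq h j x) k) =
        ∑ j ∈ Finset.Ico (i + 1) (m + 1), (-1 : K) ^ (n * p) • (-1 : K) ^ (j * p + i * n) •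
          f (fun k => insertSeq h j (insertSeq g i x) k) := fun i => by
      -- Shifting `j` by `n` lets `insertSeq_comm` exchange the insertions; the shift is the origin
      -- of the sign `(-1) ^ (n * p)`.
      rw [add_right_comm i n 1, add_right_comm m n 1, ← Finset.sum_Ico_add']
      refine Finset.sum_congr rfl fun j hj => ?_
      rw [insertSeq_comm h g (show i < j by simp at hj; omega), smul_smul, ← pow_add]
      congr 2
      ring
    simp only [h1, compLeft, Finset.smul_sum, Finset.range_eq_Ico]
    exact (Finset.sum_Ico_Ico_comm' 0 (m + 1) fun i j => (-1 : K) ^ (n * p) •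
      (-1 : K) ^ (j * p + i * n) • f (fun k => insertSeq h j (insertSeq g i x) k)).symm
  rw [hc, Finset.sum_comm, compLeft, ← Finset.sum_add_distrib, ← Finset.sum_add_distrib]
  refine Finset.sum_congr rfl fun i hi => ?_
  have hi' : i ≤ m := by simp at hi; omega
  -- The range of `j` is cut at `i` and `i + n + 1`, the ends of the block read by `g`.
  rw [Finset.range_eq_Ico, ← Finset.sum_Ico_consecutive _ (Nat.zero_le i) (show i ≤ m + n + 1 by omega),
    ← Finset.sum_Ico_consecutive _ (show i ≤ i + n + 1 by omega) (show i + n + 1 ≤ m + n + 1 by omega)]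
  have h2 : ∑ j ∈ Finset.Ico i (i + n + 1), (-1 : K) ^ (j * p + i * n) •
      f (fun k => insertSeq g i (insertSeq h j x) k) = ∑ j ∈ Finset.range (n + 1),
        (-1 : K) ^ (i * n + (i + j) * p) •
          f (fun k => insertSeq g i (insertSeq h (i + j) x) k) := by
    rw [Finset.sum_Ico_eq_sum_range, show i + n + 1 - i = n + 1 by omega]
    simp only [add_comm (_ * p) (i * n)]
  simp only [Finset.range_eq_Ico] at *
  rw [h2]
  simp only [add_comm (_ * p) (i * n)]
  abel

theorem gerstenhaberBracket_cochainOf {m n : ℕ} (f : Cochain K V V m) (g : Cochain K V V n) :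
    gerstenhaberBracket (cochainOf m f) (cochainOf n g) =
      cochainOf (m + n) (gerstenhaberComp m n f g) -
        (-1 : K) ^ (m * n) • cochainOf (n + m) (gerstenhaberComp n m g f) := by
  simp only [gerstenhaberBracket, cochainOf, DirectSum.toModule_lof, LinearMap.flip_apply,
    gerstenhaberBracketHom, LinearMap.sub_apply, LinearMap.smul_apply, LinearMap.compr₂_apply]

theorem gerstenhaberComp_preLie {m n p : ℕ} (f : Cochain K V V m) (g : Cochain K V V n)
    (h : Cochain K V V p) :
    cochainOf (m + n + p) (gerstenhaberComp (m + n) p (gerstenhaberComp m n f g) h) -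
        cochainOf (m + (n + p)) (gerstenhaberComp m (n + p) f (gerstenhaberComp n p g h)) =
      (-1 : K) ^ (n * p) •
        (cochainOf (m + p + n) (gerstenhaberComp (m + p) n (gerstenhaberComp m p f h) g) -
          cochainOf (m + (p + n)) (gerstenhaberComp m (p + n) f (gerstenhaberComp p n h g))) := by
  refine cochains_ext_seq fun N x => ?_
  simp only [map_sub, map_smul, evalSeq_cochainOf, show m + p + n = m + n + p by ring,
    show m + (p + n) = m + n + p by ring, show m + (n + p) = m + n + p by ring]
  split_ifs
  · rw [gerstenhaberComp_assoc_seq f g h, gerstenhaberComp_assoc_seq f h g, mul_comm p n]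
    rcases neg_one_pow_eq_or K (n * p) with e | e <;> rw [e] <;> module
  · simp

theorem gerstenhaberBracket_cochainOf_symm {m n : ℕ} (f : Cochain K V V m) (g : Cochain K V V n) :
    gerstenhaberBracket (cochainOf m f) (cochainOf n g) =
      -((-1 : K) ^ (m * n) • gerstenhaberBracket (cochainOf n g) (cochainOf m f)) := by
  rw [gerstenhaberBracket_cochainOf, gerstenhaberBracket_cochainOf, mul_comm n m]
  rcases neg_one_pow_eq_or K (m * n) with e | e <;> rw [e] <;> module

/-- The graded commutator of a graded pre-Lie product satisfies Jacobi: the identity is a signed sum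
of the pre-Lie identities for `f`, `g` and `h` as outer factor. -/
theorem gerstenhaberBracket_cochainOf_jacobi {m n p : ℕ} (f : Cochain K V V m)
    (g : Cochain K V V n) (h : Cochain K V V p) :
    gerstenhaberBracket (cochainOf m f) (gerstenhaberBracket (cochainOf n g) (cochainOf p h)) =
      gerstenhaberBracket (gerstenhaberBracket (cochainOf m f) (cochainOf n g)) (cochainOf p h) +
        (-1 : K) ^ (m * n) • gerstenhaberBracket (cochainOf n g)
          (gerstenhaberBracket (cochainOf m f) (cochainOf p h)) := by
  have h1 := gerstenhaberComp_preLie f g h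
  have h2 := gerstenhaberComp_preLie g f h
  have h3 := gerstenhaberComp_preLie h f g
  simp only [gerstenhaberBracket_cochainOf, map_sub, map_smul, LinearMap.sub_apply,
    LinearMap.smul_apply, mul_add, add_mul, pow_add, mul_comm n m] at h1 h2 h3 ⊢
  -- The signs in that combination depend only on the parities of the three products of degrees.
  rcases neg_one_pow_eq_or K (m * n) with a | a <;>
  rcases neg_one_pow_eq_or K (m * p) with b | b <;>
  rcases neg_one_pow_eq_or K (n * p) with c | c <;>
  simp only [a, b, c, mul_one, mul_neg, neg_neg, one_smul, neg_smul] at h1 h2 h3 ⊢ <;>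
  first
  | linear_combination (norm := module) (-1 : K) • h1 + (1 : K) • h2 + (1 : K) • h3
  | linear_combination (norm := module) (-1 : K) • h1 + (1 : K) • h2 - (1 : K) • h3
  | linear_combination (norm := module) (-1 : K) • h1 - (1 : K) • h2 + (1 : K) • h3
  | linear_combination (norm := module) (-1 : K) • h1 - (1 : K) • h2 - (1 : K) • h3

end Gerstenhaber

/-! ### Derived brackets in a graded Lie algebra. -/

section GradedLie

variable {K L : Type*} [Field K] [AddCommGroup L] [Module K L]

/-- A graded Lie bracket: a bilinear map of degree `0` that is graded antisymmetric and satisfies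
the graded Jacobi identity. -/
structure IsGradedLieBracket (𝒢 : ℤ → Submodule K L) (b : L →ₗ[K] L →ₗ[K] L) : Prop where
  mem : ∀ {i j x y}, x ∈ 𝒢 i → y ∈ 𝒢 j → b x y ∈ 𝒢 (i + j)
  antisymm : ∀ {i j x y}, x ∈ 𝒢 i → y ∈ 𝒢 j → b x y = -((i * j).negOnePow • b y x)
  jacobi : ∀ {i j k x y z}, x ∈ 𝒢 i → y ∈ 𝒢 j → z ∈ 𝒢 k →
    b x (b y z) = b (b x y) z + (i * j).negOnePow • b y (b x z)

theorem negOnePow_eq_ite (n : ℤ) : n.negOnePow = if Even n then 1 else -1 := by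
  split_ifs with h
  · exact Int.negOnePow_even n h
  · exact Int.negOnePow_odd n (Int.not_even_iff_odd.mp h)

namespace IsGradedLieBracket

variable {𝒢 : ℤ → Submodule K L} {b : L →ₗ[K] L →ₗ[K] L} (hb : IsGradedLieBracket 𝒢 b)
include hb

theorem symm_of_degree_one {x y : L} (hx : x ∈ 𝒢 1) (hy : y ∈ 𝒢 1) : b x y = b y x := by
  have := hb.antisymm hx hy
  simpa using this

/-- For odd `δ`, Jacobi with `δ` twice says that `b δ (b δ x)` equals its own negative when `b δ δ =
0`; this is where 2 must be invertible. -/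
theorem square_zero (h2 : (2 : K) ≠ 0) {δ x : L} {i : ℤ} (hδ : δ ∈ 𝒢 1) (h : b δ δ = 0)
    (hx : x ∈ 𝒢 i) : b δ (b δ x) = 0 := by
  have h1 := hb.jacobi hδ hδ hx
  rw [h] at h1
  simp only [mul_one, Int.negOnePow_one, map_zero, LinearMap.zero_apply, zero_add, Units.smul_def,
    Units.val_neg, Units.val_one, neg_smul, one_smul] at h1
  have h3 : (2 : K) • b δ (b δ x) = 0 := by
    rw [two_smul]; nth_rw 1 [h1]; exact neg_add_cancel _
  exact (smul_eq_zero.mp h3).resolve_left h2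

/-- Expand `b φ (b x y) = 0` by Jacobi. The odd degree of `φ` turns graded antisymmetry into graded
symmetry. -/
theorem derived_symm {φ x y : L} {i j : ℤ} (hφ : φ ∈ 𝒢 1) (hx : x ∈ 𝒢 i) (hy : y ∈ 𝒢 j)
    (hxy : b x y = 0) : b (b φ x) y = (i * j).negOnePow • b (b φ y) x := by
  have h1 := hb.jacobi hφ hx hy
  have h2 := hb.antisymm hx (hb.mem hφ hy)
  rw [hxy, map_zero, h2] at h1
  rcases Int.even_or_odd i with hi | hi <;> rcases Int.even_or_odd j with hj | hj <;>
  simp only [negOnePow_eq_ite, Int.even_mul, Int.even_add, ← Int.not_even_iff_odd] at * <;>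
  simp [hi, hj, Units.smul_def] at h1 ⊢ <;>
  linear_combination (norm := module) -(1 : K) • h1

/-- `b δ` is an odd derivation anticommuting with `b φ`. The hypothesis `hxy` allows `derived_symm`
to put the term with `b δ y` into shuffle order. -/
theorem derived_leibniz {δ φ x y : L} {i j : ℤ} (hδ : δ ∈ 𝒢 1) (hφ : φ ∈ 𝒢 1)
    (hδφ : b δ φ = 0) (hx : x ∈ 𝒢 i) (hy : y ∈ 𝒢 j) (hxy : b x (b δ y) = 0) :
    b δ (b (b φ x) y) + b (b φ (b δ x)) y + (i * j).negOnePow • b (b φ (b δ y)) x = 0 := by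
  have h1 := hb.jacobi hδ hφ hx
  have h2 := hb.jacobi hδ (hb.mem hφ hx) hy
  have h3 := hb.derived_symm hφ hx (hb.mem hδ hy) hxy
  rw [hδφ, map_zero, LinearMap.zero_apply] at h1
  rw [h1, h3] at h2
  rw [h2]
  rcases Int.even_or_odd i with hi | hi <;> rcases Int.even_or_odd j with hj | hj <;>
  simp only [negOnePow_eq_ite, Int.even_mul, Int.even_add, ← Int.not_even_iff_odd] at * <;>
  simp [hi, hj, Units.smul_def]

/-- As `b φ` squares to zero, `b φ (b (b φ x) y)` is, up to sign, the bracket of `b φ x` and `b φ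
y`. The claim is therefore the Jacobi identity of `b φ x`, `b φ y`, `z`, reordered by
`derived_symm`. -/
theorem derived_jacobi (h2 : (2 : K) ≠ 0) {φ x y z : L} {i j k : ℤ} (hφ : φ ∈ 𝒢 1)
    (h : b φ φ = 0) (hx : x ∈ 𝒢 i) (hy : y ∈ 𝒢 j) (hz : z ∈ 𝒢 k)
    (hxz : b x (b (b φ y) z) = 0) (hyz : b y (b (b φ x) z) = 0) :
    b (b φ (b (b φ x) y)) z + (j * k).negOnePow • b (b φ (b (b φ x) z)) y +
      (i * (j + k)).negOnePow • b (b φ (b (b φ y) z)) x = 0 := by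
  have e1 := hb.jacobi hφ (hb.mem hφ hx) hy
  have e2 := hb.jacobi (hb.mem hφ hx) (hb.mem hφ hy) hz
  have e3 := hb.derived_symm hφ hx (hb.mem (hb.mem hφ hy) hz) hxz
  have e4 := hb.derived_symm hφ hy (hb.mem (hb.mem hφ hx) hz) hyz
  rw [hb.square_zero h2 hφ h hx, map_zero, LinearMap.zero_apply, zero_add] at e1
  rw [e3, e4] at e2
  rw [e1]
  rcases Int.even_or_odd i with hi | hi <;> rcases Int.even_or_odd j with hj | hj <;>
  rcases Int.even_or_odd k with hk | hk <;>
  simp only [negOnePow_eq_ite, Int.even_mul, Int.even_add, ← Int.not_even_iff_odd] at * <;>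
  simp [hi, hj, hk, Units.smul_def] at e2 ⊢ <;>
  first
  | linear_combination (norm := module) (1 : K) • e2
  | linear_combination (norm := module) -(1 : K) • e2

end IsGradedLieBracket

end GradedLie

/-! ### The degree grading, and the graded Lie algebra of cochains. -/

section CochainGrading

variable {K V N : Type*} [Field K] [AddCommGroup V] [Module K V] [AddCommGroup N] [Module K N]

theorem cochainOf_mem_cochainDegree (n : ℕ) (f : Cochain K V N n) :
    cochainOf n f ∈ cochainDegree K V N n := by
  intro m hm
  rw [DirectSum.lof_eq_of, DirectSum.of_eq_of_ne]
  exact_mod_cast hm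

theorem eq_cochainOf_of_mem_cochainDegree {i : ℤ} {F : Cochains K V N}
    (hF : F ∈ cochainDegree K V N i) :
    F = 0 ∨ ∃ (n : ℕ) (f : Cochain K V N n), i = n ∧ F = cochainOf n f := by
  by_cases hi : 0 ≤ i
  · lift i to ℕ using hi
    refine Or.inr ⟨i, F i, rfl, DFinsupp.ext fun m => ?_⟩
    rw [DirectSum.lof_eq_of]
    by_cases h : m = i
    · subst h; exact (DirectSum.of_eq_same m _).symm
    · rw [hF m (by exact_mod_cast h)]
      exact (DirectSum.of_eq_of_ne _ _ _ h).symm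
  · exact Or.inl (DFinsupp.ext fun m => hF m (by omega))

theorem negOnePow_mul_smul (m n : ℕ) (F : Cochains K V N) :
    ((m : ℤ) * n).negOnePow • F = (-1 : K) ^ (m * n) • F := by
  rcases Nat.even_or_odd (m * n) with h | h
  · rw [h.neg_one_pow, Int.negOnePow_even _ (by exact_mod_cast h), one_smul, one_smul]
  · rw [h.neg_one_pow, Int.negOnePow_odd _ (by exact_mod_cast h), neg_smul, one_smul,
      Units.neg_smul, one_smul]

theorem isInternal_cochainDegree : DirectSum.IsInternal (cochainDegree K V N) := by
  refine DirectSum.isInternal_submodule_of_iSupIndep_of_iSup_eq_top ?_ ?_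
  · intro i
    rw [Submodule.disjoint_def]
    intro F hF hF'
    -- The kernel of the `i`-th component contains every other homogeneous part, which gives
    -- independence.
    let S : Submodule K (Cochains K V N) :=
      { carrier := {F | ∀ n : ℕ, (n : ℤ) = i → F n = 0}
        add_mem' := fun {f g} hf hg n hn => by
          rw [DirectSum.add_apply, hf n hn, hg n hn, add_zero]
        zero_mem' := fun _ _ => rfl
        smul_mem' := fun c f hf n hn => by rw [DirectSum.smul_apply, hf n hn, smul_zero] }
    have hS : (⨆ (j) (_ : j ≠ i), cochainDegree K V N j) ≤ S :=
      iSup₂_le fun j hj G hG n hn => hG n (by omega)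
    refine DFinsupp.ext fun n => ?_
    by_cases h : (n : ℤ) = i
    · exact hS hF' n h
    · exact hF n h
  · classical
    rw [eq_top_iff]
    intro F _
    rw [← DirectSum.sum_support_of F]
    exact Submodule.sum_mem _ fun n _ =>
      Submodule.mem_iSup_of_mem (n : ℤ) (cochainOf_mem_cochainDegree n (F n))

theorem isGradedLieBracket_gerstenhaberBracket :
    IsGradedLieBracket (cochainDegree K V V) gerstenhaberBracket where
  mem {i j x y} hx hy := by
    rcases eq_cochainOf_of_mem_cochainDegree hx with rfl | ⟨m, f, rfl, rfl⟩
    · simp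
    rcases eq_cochainOf_of_mem_cochainDegree hy with rfl | ⟨n, g, rfl, rfl⟩
    · simp
    rw [gerstenhaberBracket_cochainOf]
    refine Submodule.sub_mem _ ?_ (Submodule.smul_mem _ _ ?_)
    · exact_mod_cast cochainOf_mem_cochainDegree _ _
    · rw [add_comm]
      exact_mod_cast cochainOf_mem_cochainDegree _ _
  antisymm {i j x y} hx hy := by
    rcases eq_cochainOf_of_mem_cochainDegree hx with rfl | ⟨m, f, rfl, rfl⟩
    · simp
    rcases eq_cochainOf_of_mem_cochainDegree hy with rfl | ⟨n, g, rfl, rfl⟩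
    · simp
    rw [negOnePow_mul_smul, gerstenhaberBracket_cochainOf_symm]
  jacobi {i j k x y z} hx hy hz := by
    rcases eq_cochainOf_of_mem_cochainDegree hx with rfl | ⟨m, f, rfl, rfl⟩
    · simp
    rcases eq_cochainOf_of_mem_cochainDegree hy with rfl | ⟨n, g, rfl, rfl⟩
    · simp
    rcases eq_cochainOf_of_mem_cochainDegree hz with rfl | ⟨p, h, rfl, rfl⟩
    · simp
    rw [negOnePow_mul_smul, gerstenhaberBracket_cochainOf_jacobi]

end CochainGrading

/-! ### Weights of cochains on `𝒜`, with `A` in degree 0 and `A'` in degree 1. -/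

section Weights

/-- Degree count for an insertion: contracting a block to one entry of degree `b` less lowers the
total by `b`. Hence weights add under composition. -/
theorem sum_range_insert_index (m n i : ℕ) (hi : i < m + 1) (d : ℕ → ℤ) (b : ℤ) :
    ∑ j ∈ Finset.range (m + 1), (if j < i then d j else if j = i then
      ∑ k ∈ Finset.range (n + 1), d (i + k) - b else d (j + n)) =
      ∑ j ∈ Finset.range (m + n + 1), d j - b := by
  obtain ⟨r, rfl⟩ : ∃ r, m = i + r := ⟨m - i, by omega⟩
  rw [show i + r + n + 1 = i + (n + 1 + r) by omega, show i + r + 1 = i + (1 + r) by omega,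
    Finset.sum_range_add, Finset.sum_range_add _ 1, Finset.sum_range_add _ i,
    Finset.sum_range_add _ (n + 1)]
  have h1 : ∀ j ∈ Finset.range i, (if j < i then d j else if j = i then
      ∑ k ∈ Finset.range (n + 1), d (i + k) - b else d (j + n)) = d j := fun j hj =>
    if_pos (Finset.mem_range.mp hj)
  have h2 : ∀ j ∈ Finset.range r, (if i + (1 + j) < i then d (i + (1 + j)) else
      if i + (1 + j) = i then ∑ k ∈ Finset.range (n + 1), d (i + k) - b else d (i + (1 + j) + n)) =
      d (i + (n + 1 + j)) := fun j _ => by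
    rw [if_neg (by omega), if_neg (by omega)]
    congr 1; omega
  rw [Finset.sum_congr rfl h1, Finset.sum_congr rfl h2]
  simp
  ring

namespace QuasiTwilled

variable {K 𝒜 : Type*} [Field K] [NonUnitalRing 𝒜] [Module K 𝒜]
  [SMulCommClass K 𝒜 𝒜] [IsScalarTower K 𝒜 𝒜] (Q : QuasiTwilled K 𝒜)

/-- The grading of `𝒜` with `A` in degree `0` and `A'` in degree `1`. -/
def part (i : ℤ) : Submodule K 𝒜 := if i = 0 then Q.A else if i = 1 then Q.A' else ⊥

/-- The projection of `𝒜` onto the part of degree `i`. -/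
def partProj (i : ℤ) : 𝒜 →ₗ[K] 𝒜 :=
  if i = 0 then Q.A.subtype.comp Q.pr else if i = 1 then Q.A'.subtype.comp Q.pr' else 0

theorem pr_of_mem {x : 𝒜} (hx : x ∈ Q.A) : Q.pr x = ⟨x, hx⟩ :=
  Submodule.projectionOnto_apply_left Q.isCompl ⟨x, hx⟩

theorem pr_of_mem' {x : 𝒜} (hx : x ∈ Q.A') : Q.pr x = 0 :=
  (Submodule.projectionOnto_apply_eq_zero_iff Q.isCompl).mpr hx

theorem pr'_of_mem' {x : 𝒜} (hx : x ∈ Q.A') : Q.pr' x = ⟨x, hx⟩ :=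
  Submodule.projectionOnto_apply_left Q.isCompl.symm ⟨x, hx⟩

theorem pr'_of_mem {x : 𝒜} (hx : x ∈ Q.A) : Q.pr' x = 0 :=
  (Submodule.projectionOnto_apply_eq_zero_iff Q.isCompl.symm).mpr hx

theorem pr_add_pr' (x : 𝒜) : (Q.pr x : 𝒜) + Q.pr' x = x :=
  Submodule.projection_add_projection_eq_self Q.isCompl x

theorem partProj_of_mem {i : ℤ} {x : 𝒜} (hx : x ∈ Q.part i) : Q.partProj i x = x := by
  unfold part at hx
  unfold partProj
  split_ifs at hx ⊢
  · simp [Q.pr_of_mem hx]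
  · simp [Q.pr'_of_mem' hx]
  · simpa using hx.symm

theorem partProj_of_mem_ne {i j : ℤ} (h : i ≠ j) {x : 𝒜} (hx : x ∈ Q.part j) :
    Q.partProj i x = 0 := by
  unfold part at hx
  unfold partProj
  split_ifs at hx ⊢ <;> first | omega | skip
  · simp [Q.pr_of_mem' hx]
  · rw [(Submodule.mem_bot K).mp hx, map_zero]
  · simp [Q.pr'_of_mem hx]
  · rw [(Submodule.mem_bot K).mp hx, map_zero]
  all_goals rfl

/-- The cochains of weight `w`: they map `part i₀ ⊗ ⋯ ⊗ part iₙ` to `part (i₀ + ⋯ + iₙ - w)`. -/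
def weight (w : ℤ) : Submodule K (Cochains K 𝒜 𝒜) where
  carrier := {F | ∀ (n : ℕ) (d : ℕ → ℤ) (x : ℕ → 𝒜), (∀ j, x j ∈ Q.part (d j)) →
    evalSeq n x F ∈ Q.part (∑ j ∈ Finset.range (n + 1), d j - w)}
  add_mem' hF hG n d x hx := by
    rw [map_add]; exact add_mem (hF n d x hx) (hG n d x hx)
  zero_mem' n d x hx := by rw [map_zero]; exact zero_mem _
  smul_mem' c F hF n d x hx := by
    rw [map_smul]; exact Submodule.smul_mem _ c (hF n d x hx)

/-- The cochains without component of weight `w`. -/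
def offWeight (w : ℤ) : Submodule K (Cochains K 𝒜 𝒜) where
  carrier := {F | ∀ (n : ℕ) (d : ℕ → ℤ) (x : ℕ → 𝒜), (∀ j, x j ∈ Q.part (d j)) →
    Q.partProj (∑ j ∈ Finset.range (n + 1), d j - w) (evalSeq n x F) = 0}
  add_mem' hF hG n d x hx := by
    rw [map_add, map_add, hF n d x hx, hG n d x hx, add_zero]
  zero_mem' n d x hx := by rw [map_zero, map_zero]
  smul_mem' c F hF n d x hx := by
    rw [map_smul, map_smul, hF n d x hx, smul_zero]

theorem weight_le_offWeight {v w : ℤ} (h : v ≠ w) : Q.weight v ≤ Q.offWeight w :=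
  fun F hF n d x hx => Q.partProj_of_mem_ne (by omega) (hF n d x hx)

theorem cochain_ext_parts {N : Type*} [AddCommGroup N] [Module K N] {n : ℕ}
    {f g : Cochain K 𝒜 N n}
    (h : ∀ (d : ℕ → ℤ) (x : ℕ → 𝒜), (∀ j, d j = 0 ∨ d j = 1) → (∀ j, x j ∈ Q.part (d j)) →
      f (fun k => x k) = g (fun k => x k)) : f = g := by
  classical
  refine cochain_ext_seq fun x => ?_
  have hx : (fun k : Fin (n + 1) => x k) =
      (fun k : Fin (n + 1) => (Q.pr (x k) : 𝒜)) + fun k : Fin (n + 1) => (Q.pr' (x k) : 𝒜) := by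
    funext k
    exact (Q.pr_add_pr' (x k)).symm
  rw [hx, MultilinearMap.map_add_univ, MultilinearMap.map_add_univ]
  refine Finset.sum_congr rfl fun s _ => ?_
  have := h (fun j => if ∃ hj : j < n + 1, (⟨j, hj⟩ : Fin (n + 1)) ∈ s then 0 else 1)
    (fun j => if ∃ hj : j < n + 1, (⟨j, hj⟩ : Fin (n + 1)) ∈ s then Q.pr (x j) else Q.pr' (x j))
    (fun j => by split_ifs <;> simp)
    (fun j => by split_ifs <;> simp [part])
  convert this using 2 <;>
  · funext k
    by_cases hk : k ∈ s <;> simp [hk, -Order.lt_add_one_iff]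

theorem cochains_ext_parts {F G : Cochains K 𝒜 𝒜}
    (h : ∀ (n : ℕ) (d : ℕ → ℤ) (x : ℕ → 𝒜), (∀ j, d j = 0 ∨ d j = 1) →
      (∀ j, x j ∈ Q.part (d j)) → evalSeq n x F = evalSeq n x G) : F = G :=
  DFinsupp.ext fun n => Q.cochain_ext_parts fun d x hd hx => h n d x hd hx

/-- Projecting each value to the degree prescribed by weight `w` keeps `F` and kills `R`. This
isolates one weight in a sum that vanishes. -/
theorem eq_zero_of_weight {w : ℤ} {F R : Cochains K 𝒜 𝒜} (hF : F ∈ Q.weight w)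
    (hR : R ∈ Q.offWeight w) (h : F + R = 0) : F = 0 := by
  refine Q.cochains_ext_parts fun n d x _ hx => ?_
  have h1 := congrArg (fun G => Q.partProj (∑ j ∈ Finset.range (n + 1), d j - w) (evalSeq n x G)) h
  simp only [map_add, map_zero, hR n d x hx, add_zero] at h1 ⊢
  rwa [Q.partProj_of_mem (hF n d x hx)] at h1

/-- Inputs have total degree at least 0, so the output would have degree at least 2, where `𝒜` is
zero. -/
theorem eq_zero_of_weight_lt {w : ℤ} (hw : w < -1) {F : Cochains K 𝒜 𝒜} (hF : F ∈ Q.weight w) :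
    F = 0 := by
  refine Q.cochains_ext_parts fun n d x hd hx => ?_
  have h1 := hF n d x hx
  have h2 : 0 ≤ ∑ j ∈ Finset.range (n + 1), d j :=
    Finset.sum_nonneg fun j _ => by rcases hd j with h | h <;> omega
  rw [part, if_neg (by omega), if_neg (by omega)] at h1
  rw [map_zero]
  exact (Submodule.mem_bot K).mp h1

theorem cochainOf_mem_weight {w : ℤ} {n : ℕ} {f : Cochain K 𝒜 𝒜 n} :
    cochainOf n f ∈ Q.weight w ↔ ∀ (d : ℕ → ℤ) (x : ℕ → 𝒜), (∀ j, x j ∈ Q.part (d j)) →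
      f (fun k => x k) ∈ Q.part (∑ j ∈ Finset.range (n + 1), d j - w) := by
  constructor
  · intro h d x hx
    have := h n d x hx
    rwa [evalSeq_cochainOf, if_pos rfl] at this
  · intro h m d x hx
    rw [evalSeq_cochainOf]
    split_ifs with hm
    · subst hm; exact h d x hx
    · exact zero_mem _

theorem gerstenhaberComp_mem_weight {v w : ℤ} {m n : ℕ} {f : Cochain K 𝒜 𝒜 m}
    {g : Cochain K 𝒜 𝒜 n} (hf : cochainOf m f ∈ Q.weight v) (hg : cochainOf n g ∈ Q.weight w) :
    cochainOf (m + n) (gerstenhaberComp m n f g) ∈ Q.weight (v + w) := by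
  rw [cochainOf_mem_weight] at *
  intro d x hx
  rw [gerstenhaberComp_seq]
  refine Submodule.sum_mem _ fun i hi => Submodule.smul_mem _ _ ?_
  have := hf (fun j => if j < i then d j else if j = i then
      ∑ k ∈ Finset.range (n + 1), d (i + k) - w else d (j + n)) (insertSeq g i x) (fun j => by
    simp only [insertSeq]
    split_ifs
    · exact hx j
    · exact hg (fun k => d (i + k)) (fun k => x (i + k)) fun k => hx _
    · exact hx _)
  rw [sum_range_insert_index m n i (by simpa using hi)] at this
  rwa [show ∑ j ∈ Finset.range (m + n + 1), d j - (v + w) =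
    ∑ j ∈ Finset.range (m + n + 1), d j - w - v by ring]

theorem cochainOf_apply_mem_weight {w : ℤ} {F : Cochains K 𝒜 𝒜} (hF : F ∈ Q.weight w) (n : ℕ) :
    cochainOf n (F n) ∈ Q.weight w :=
  Q.cochainOf_mem_weight.mpr fun d x hx => hF n d x hx

theorem gerstenhaberBracket_mem_weight {v w : ℤ} {F G : Cochains K 𝒜 𝒜} (hF : F ∈ Q.weight v)
    (hG : G ∈ Q.weight w) : gerstenhaberBracket F G ∈ Q.weight (v + w) := by
  classical
  rw [← DirectSum.sum_support_of F, ← DirectSum.sum_support_of G, map_sum]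
  refine Submodule.sum_mem _ fun n _ => ?_
  rw [map_sum, LinearMap.sum_apply]
  refine Submodule.sum_mem _ fun m _ => ?_
  have hf := Q.cochainOf_apply_mem_weight hF m
  have hg := Q.cochainOf_apply_mem_weight hG n
  have := Submodule.sub_mem _ (Q.gerstenhaberComp_mem_weight hf hg)
    (Submodule.smul_mem _ ((-1 : K) ^ (m * n)) (add_comm w v ▸ Q.gerstenhaberComp_mem_weight hg hf))
  rwa [← gerstenhaberBracket_cochainOf] at this

theorem lift_apply (F : Cochains K Q.A Q.A') (n : ℕ) (x : ℕ → 𝒜) :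
    evalSeq n x (Q.lift F) = ((evalSeq n (fun k => Q.pr (x k)) F : Q.A') : 𝒜) := rfl

theorem proj_apply (F : Cochains K 𝒜 𝒜) (n : ℕ) (x : ℕ → Q.A) :
    evalSeq n x (Q.proj F) = Q.pr' (evalSeq n (fun k => (x k : 𝒜)) F) := rfl

theorem lift_mem_weight (F : Cochains K Q.A Q.A') : Q.lift F ∈ Q.weight (-1) := by
  intro n d x hx
  rw [lift_apply]
  by_cases h : ∀ j ∈ Finset.range (n + 1), d j = 0
  · rw [Finset.sum_eq_zero h, part, if_neg (by omega), if_pos (by omega)]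
    exact Submodule.coe_mem _
  · push Not at h
    obtain ⟨j, hj, hd⟩ := h
    have hp : Q.pr (x j) = 0 := by
      have := hx j
      rw [part, if_neg hd] at this
      split_ifs at this
      · exact Q.pr_of_mem' this
      · rw [(Submodule.mem_bot K).mp this, map_zero]
    rw [evalSeq_apply, (F n).map_coord_zero ⟨j, by simpa using hj⟩ hp]
    exact zero_mem _

theorem proj_lift (F : Cochains K Q.A Q.A') : Q.proj (Q.lift F) = F := by
  refine cochains_ext_seq fun n x => ?_
  rw [proj_apply, lift_apply, Q.pr'_of_mem' (Submodule.coe_mem _)]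
  simp [Q.pr_of_mem]

theorem lift_injective : Function.Injective Q.lift :=
  Function.LeftInverse.injective Q.proj_lift

/-- An argument from `A'` forces output degree at least 2, so a cochain of weight -1 lives on
tensors of `A` alone, with values in `A'`. With `lift_mem_weight`, the image of `lift` is exactly
weight -1. -/
theorem lift_proj {F : Cochains K 𝒜 𝒜} (hF : F ∈ Q.weight (-1)) : Q.lift (Q.proj F) = F := by
  refine Q.cochains_ext_parts fun n d x hd hx => ?_
  rw [lift_apply, proj_apply]
  by_cases h : ∀ j ∈ Finset.range (n + 1), d j = 0
  · have hx' : ∀ j : Fin (n + 1), (Q.pr (x j) : 𝒜) = x j := fun j => by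
      have := hx j
      rw [h j (Finset.mem_range.mpr j.is_lt), part, if_pos rfl] at this
      rw [Q.pr_of_mem this]
    have h1 := hF n d x hx
    rw [Finset.sum_eq_zero h, part, if_neg (by omega), if_pos (by omega)] at h1
    have h2 : evalSeq n (fun k => (Q.pr (x k) : 𝒜)) F = evalSeq n x F := by
      rw [evalSeq_apply, evalSeq_apply]
      congr 1
      funext j
      exact hx' j
    rw [h2, Q.pr'_of_mem' h1]
  · push Not at h
    obtain ⟨j, hj, hdj⟩ := h
    have hd1 : d j = 1 := (hd j).resolve_left hdj
    have h1 := hx j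
    rw [hd1, part, if_neg (by omega), if_pos rfl] at h1
    have h2 := hF n d x hx
    have h3 : 1 ≤ ∑ j ∈ Finset.range (n + 1), d j :=
      hd1 ▸ Finset.single_le_sum (f := d) (fun j _ => by rcases hd j with h | h <;> omega) hj
    rw [part, if_neg (by omega), if_neg (by omega)] at h2
    rw [(Submodule.mem_bot K).mp h2, evalSeq_apply,
      (F n).map_coord_zero ⟨j, by simpa using hj⟩ (by simp [Q.pr_of_mem' h1])]
    simp

end QuasiTwilled

end Weights

/-! ### Brackets of bilinear and linear maps. -/

section Bilinear

variable {K V N : Type*} [Field K] [AddCommGroup V] [Module K V] [AddCommGroup N] [Module K N]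

theorem bilinToMultilinear_apply (B : V →ₗ[K] V →ₗ[K] N) (x : Fin (1 + 1) → V) :
    (bilinToMultilinear B : Cochain K V N 1) x = B (x 0) (x 1) := rfl

theorem evalSeq_one_bilinCochain (B : V →ₗ[K] V →ₗ[K] N) (x : ℕ → V) :
    evalSeq 1 x (bilinCochain B) = B (x 0) (x 1) := by
  rw [bilinCochain, evalSeq_cochainOf, if_pos rfl, bilinToMultilinear_apply]
  rfl

theorem linCochain_add (f g : V →ₗ[K] N) : linCochain (f + g) = linCochain f + linCochain g := by
  rw [linCochain, linCochain, linCochain, ← map_add]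
  rfl

theorem bilinCochain_mem (B : V →ₗ[K] V →ₗ[K] N) : bilinCochain B ∈ cochainDegree K V N 1 :=
  cochainOf_mem_cochainDegree 1 _

theorem linCochain_mem (f : V →ₗ[K] N) : linCochain f ∈ cochainDegree K V N 0 :=
  cochainOf_mem_cochainDegree 0 _

theorem eq_bilinCochain_of_mem {F : Cochains K V N} (hF : F ∈ cochainDegree K V N 1)
    (h : ∀ x : ℕ → V, evalSeq 1 x F = 0) : F = 0 := by
  refine cochains_ext_seq fun n x => ?_
  by_cases hn : n = 1
  · subst hn; rw [h, map_zero]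
  · rw [evalSeq_apply, hF n (by exact_mod_cast hn)]; rfl

/-- The second insertion carries the sign -1, so `B ∘ B` is the associator of `B`. -/
theorem gerstenhaberBracket_bilin_self (B : V →ₗ[K] V →ₗ[K] V)
    (h : ∀ x y z, B (B x y) z = B x (B y z)) :
    gerstenhaberBracket (bilinCochain B) (bilinCochain B) = 0 := by
  have h0 : gerstenhaberComp 1 1 (bilinToMultilinear B) (bilinToMultilinear B) = 0 := by
    refine cochain_ext_seq fun x => ?_
    rw [gerstenhaberComp_seq]
    simp [Finset.sum_range_succ, insertSeq]
    change B (B (x 0) (x 1)) (x 2) + -B (x 0) (B (x 1) (x 2)) = 0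
    rw [h, add_neg_cancel]
  rw [bilinCochain, gerstenhaberBracket_cochainOf, h0]
  simp

theorem gerstenhaberBracket_bilin_lin (B : V →ₗ[K] V →ₗ[K] V) (E : V →ₗ[K] V) (x : ℕ → V) :
    evalSeq 1 x (gerstenhaberBracket (bilinCochain B) (linCochain E)) =
      B (E (x 0)) (x 1) + B (x 0) (E (x 1)) - E (B (x 0) (x 1)) := by
  rw [bilinCochain, linCochain, gerstenhaberBracket_cochainOf, map_sub, map_smul,
    evalSeq_cochainOf, evalSeq_cochainOf, if_pos rfl, if_pos rfl, gerstenhaberComp_seq]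
  have := gerstenhaberComp_seq (MultilinearMap.ofSubsingleton K V V (0 : Fin 1) E)
    (bilinToMultilinear B) x
  erw [this]
  simp [Finset.sum_range_succ, insertSeq]
  rfl

end Bilinear

/-! ### Weight components of the multiplication, and the untwisted operations. -/

namespace QuasiTwilled

variable {K 𝒜 : Type*} [Field K] [NonUnitalRing 𝒜] [Module K 𝒜]
  [SMulCommClass K 𝒜 𝒜] [IsScalarTower K 𝒜 𝒜] (Q : QuasiTwilled K 𝒜)

theorem bilinCochain_mem_weight {w : ℤ} {B : 𝒜 →ₗ[K] 𝒜 →ₗ[K] 𝒜}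
    (h : ∀ i j : ℤ, (i = 0 ∨ i = 1) → (j = 0 ∨ j = 1) → ∀ x ∈ Q.part i, ∀ y ∈ Q.part j,
      B x y ∈ Q.part (i + j - w)) : bilinCochain B ∈ Q.weight w := by
  rw [bilinCochain, cochainOf_mem_weight]
  intro d x hx
  rw [bilinToMultilinear_apply, Finset.sum_range_succ, Finset.sum_range_one]
  change B (x 0) (x 1) ∈ _
  have hp : ∀ i : ℤ, (i = 0 ∨ i = 1) ∨ Q.part i = ⊥ := fun i => by
    unfold part; split_ifs <;> simp_all
  have h0 := hx 0
  have h1 := hx 1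
  rcases hp (d 0) with e0 | e0
  · rcases hp (d 1) with e1 | e1
    · exact h _ _ e0 e1 _ h0 _ h1
    · rw [e1, Submodule.mem_bot] at h1
      rw [h1, map_zero]; exact zero_mem _
  · rw [e0, Submodule.mem_bot] at h0
    rw [h0, map_zero]; exact zero_mem _

theorem liftπρμ_mem_weight : bilinCochain Q.liftπρμ ∈ Q.weight 0 := by
  apply Q.bilinCochain_mem_weight
  rintro i j (rfl | rfl) (rfl | rfl) x hx y hy <;> simp only [part] at hx hy ⊢ <;>
    simp at hx hy ⊢ <;>
    simp [liftπρμ, pr_of_mem, pr_of_mem', pr'_of_mem, pr'_of_mem', hx, hy]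

theorem liftξηβ_mem_weight : bilinCochain Q.liftξηβ ∈ Q.weight 1 := by
  apply Q.bilinCochain_mem_weight
  rintro i j (rfl | rfl) (rfl | rfl) x hx y hy <;> simp only [part] at hx hy ⊢ <;>
    simp at hx hy ⊢ <;>
    simp [liftξηβ, pr_of_mem, pr_of_mem', pr'_of_mem, pr'_of_mem', hx, hy]

theorem evalSeq_one_lift_l₀ (x : ℕ → 𝒜) :
    evalSeq 1 x (Q.lift Q.l₀) = (Q.θ (Q.pr (x 0)) (Q.pr (x 1)) : 𝒜) := by
  rw [lift_apply, l₀, evalSeq_one_bilinCochain]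

theorem lift_mem_cochainDegree {i : ℤ} {F : Cochains K Q.A Q.A'}
    (hF : F ∈ cochainDegree K Q.A Q.A' i) : Q.lift F ∈ cochainDegree K 𝒜 𝒜 i := by
  intro n hn
  rw [lift, DirectSum.lmap_apply, hF n hn, map_zero]

theorem proj_mem_cochainDegree {i : ℤ} {F : Cochains K 𝒜 𝒜}
    (hF : F ∈ cochainDegree K 𝒜 𝒜 i) : Q.proj F ∈ cochainDegree K Q.A Q.A' i := by
  intro n hn
  rw [proj, DirectSum.lmap_apply, hF n hn, map_zero]

theorem mul_eq_components (x y : 𝒜) :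
    x * y = (Q.θ (Q.pr x) (Q.pr y) : 𝒜) + Q.liftπρμ x y + Q.liftξηβ x y := by
  -- Closure of `A'` under multiplication removes the only possible component of weight 2.
  have hm : Q.pr (Q.pr' x * Q.pr' y : 𝒜) = 0 :=
    Q.pr_of_mem' (Q.mul_mem _ (Q.pr' x).2 _ (Q.pr' y).2)
  have h : ∀ a b : 𝒜, (Q.pr (a * b) : 𝒜) + Q.pr' (a * b) = a * b := fun a b => Q.pr_add_pr' _
  conv_lhs => rw [← Q.pr_add_pr' x, ← Q.pr_add_pr' y, add_mul, mul_add, mul_add, ← h (Q.pr x) (Q.pr y),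
    ← h (Q.pr x) (Q.pr' y), ← h (Q.pr' x) (Q.pr y), ← h (Q.pr' x) (Q.pr' y), hm]
  simp [liftπρμ, liftξηβ, θ, π, ρ, μ, ξ, η, β]
  abel

theorem bilinCochain_mul :
    bilinCochain (LinearMap.mul K 𝒜) =
      Q.lift Q.l₀ + bilinCochain Q.liftπρμ + bilinCochain Q.liftξηβ := by
  rw [← sub_eq_zero]
  apply eq_bilinCochain_of_mem
  · exact Submodule.sub_mem _ (bilinCochain_mem _) (Submodule.add_mem _ (Submodule.add_mem _
      (Q.lift_mem_cochainDegree (bilinCochain_mem _)) (bilinCochain_mem _)) (bilinCochain_mem _))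
  · intro x
    simp only [map_sub, map_add, evalSeq_one_bilinCochain, evalSeq_one_lift_l₀]
    rw [LinearMap.mul_apply', Q.mul_eq_components, sub_self]

/-- These are the components of weight 2, 1 and 0 of the vanishing square of the multiplication. In
each case `R` collects the remaining weights. -/
theorem bracket_relations (hK : (2 : K) ≠ 0) :
    gerstenhaberBracket (bilinCochain Q.liftξηβ) (bilinCochain Q.liftξηβ) = 0 ∧
    gerstenhaberBracket (bilinCochain Q.liftπρμ) (bilinCochain Q.liftξηβ) = 0 ∧
    gerstenhaberBracket (bilinCochain Q.liftπρμ) (bilinCochain Q.liftπρμ) +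
      (2 : K) • gerstenhaberBracket (bilinCochain Q.liftξηβ) (Q.lift Q.l₀) = 0 := by
  have h := gerstenhaberBracket_bilin_self (LinearMap.mul K 𝒜) (fun x y z => mul_assoc x y z)
  have hp := Q.liftπρμ_mem_weight
  have hq := Q.liftξηβ_mem_weight
  have ht := Q.lift_mem_weight Q.l₀
  have dp : bilinCochain Q.liftπρμ ∈ cochainDegree K 𝒜 𝒜 1 := bilinCochain_mem _
  have dq : bilinCochain Q.liftξηβ ∈ cochainDegree K 𝒜 𝒜 1 := bilinCochain_mem _
  have dt : Q.lift Q.l₀ ∈ cochainDegree K 𝒜 𝒜 1 := Q.lift_mem_cochainDegree (bilinCochain_mem _)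
  rw [bilinCochain_mul] at h
  generalize bilinCochain Q.liftπρμ = p at *
  generalize bilinCochain Q.liftξηβ = q at *
  generalize Q.lift Q.l₀ = t at *
  have hb := isGradedLieBracket_gerstenhaberBracket (K := K) (V := 𝒜)
  have s1 := hb.symm_of_degree_one dt dp
  have s2 := hb.symm_of_degree_one dt dq
  have s3 := hb.symm_of_degree_one dq dp
  have w22 := Q.gerstenhaberBracket_mem_weight hq hq
  have w12 := Q.gerstenhaberBracket_mem_weight hp hq
  have w11 := Q.gerstenhaberBracket_mem_weight hp hp
  have w20 := Q.gerstenhaberBracket_mem_weight hq ht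
  have w10 := Q.gerstenhaberBracket_mem_weight hp ht
  have w00 := Q.gerstenhaberBracket_mem_weight ht ht
  simp only [map_add, LinearMap.add_apply, s1, s2, s3] at h
  generalize gerstenhaberBracket q q = qq at *
  generalize gerstenhaberBracket p q = pq at *
  generalize gerstenhaberBracket p p = pp at *
  generalize gerstenhaberBracket q t = qt at *
  generalize gerstenhaberBracket p t = pt at *
  generalize gerstenhaberBracket t t = tt at *
  norm_num at w22 w12 w11 w20 w10 w00
  have w11' : pp + (2 : K) • qt ∈ Q.weight 0 := add_mem w11 (Submodule.smul_mem _ _ w20)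
  have w12' : (2 : K) • pq ∈ Q.weight 1 := Submodule.smul_mem _ _ w12
  have w10' : (2 : K) • pt ∈ Q.weight (-1) := Submodule.smul_mem _ _ w10
  refine ⟨?_, ?_, ?_⟩
  · refine Q.eq_zero_of_weight (R := (2 : K) • pq + (pp + (2 : K) • qt) + (2 : K) • pt + tt) w22
      (add_mem (add_mem (add_mem ?_ ?_) ?_) ?_) ?_
    · exact Q.weight_le_offWeight (by norm_num) w12'
    · exact Q.weight_le_offWeight (by norm_num) w11'
    · exact Q.weight_le_offWeight (by norm_num) w10'
    · exact Q.weight_le_offWeight (by norm_num) w00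
    · linear_combination (norm := module) (1 : K) • h
  · refine (smul_eq_zero.mp (?_ : (2 : K) • pq = 0)).resolve_left hK
    refine Q.eq_zero_of_weight (R := qq + (pp + (2 : K) • qt) + (2 : K) • pt + tt) w12'
      (add_mem (add_mem (add_mem ?_ ?_) ?_) ?_) ?_
    · exact Q.weight_le_offWeight (by norm_num) w22
    · exact Q.weight_le_offWeight (by norm_num) w11'
    · exact Q.weight_le_offWeight (by norm_num) w10'
    · exact Q.weight_le_offWeight (by norm_num) w00
    · linear_combination (norm := module) (1 : K) • h
  · refine Q.eq_zero_of_weight (R := qq + (2 : K) • pq + (2 : K) • pt + tt) w11'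
      (add_mem (add_mem (add_mem ?_ ?_) ?_) ?_) ?_
    · exact Q.weight_le_offWeight (by norm_num) w22
    · exact Q.weight_le_offWeight (by norm_num) w12'
    · exact Q.weight_le_offWeight (by norm_num) w10'
    · exact Q.weight_le_offWeight (by norm_num) w00
    · linear_combination (norm := module) (1 : K) • h

/-- The bracket already has weight 0 + (-1) = -1, so `proj` discards nothing. -/
theorem lift_l₁ (f : Cochains K Q.A Q.A') :
    Q.lift (Q.l₁ f) = gerstenhaberBracket (bilinCochain Q.liftπρμ) (Q.lift f) :=
  Q.lift_proj (zero_add (-1 : ℤ) ▸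
    Q.gerstenhaberBracket_mem_weight Q.liftπρμ_mem_weight (Q.lift_mem_weight f))

theorem lift_l₂ (f g : Cochains K Q.A Q.A') :
    Q.lift (Q.l₂ f g) =
      gerstenhaberBracket (gerstenhaberBracket (bilinCochain Q.liftξηβ) (Q.lift f)) (Q.lift g) := by
  refine Q.lift_proj ?_
  have := Q.gerstenhaberBracket_mem_weight
    (Q.gerstenhaberBracket_mem_weight Q.liftξηβ_mem_weight (Q.lift_mem_weight f))
    (Q.lift_mem_weight g)
  simpa using this

theorem bracket_lift_lift (f g : Cochains K Q.A Q.A') :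
    gerstenhaberBracket (Q.lift f) (Q.lift g) = 0 :=
  Q.eq_zero_of_weight_lt (by norm_num)
    (Q.gerstenhaberBracket_mem_weight (Q.lift_mem_weight f) (Q.lift_mem_weight g))

theorem l₁_mem {i : ℤ} {f : Cochains K Q.A Q.A'} (hf : f ∈ cochainDegree K Q.A Q.A' i) :
    Q.l₁ f ∈ cochainDegree K Q.A Q.A' (i + 1) := by
  rw [add_comm]
  exact Q.proj_mem_cochainDegree (isGradedLieBracket_gerstenhaberBracket.mem (bilinCochain_mem _)
    (Q.lift_mem_cochainDegree hf))

theorem l₂_mem {i j : ℤ} {f g : Cochains K Q.A Q.A'} (hf : f ∈ cochainDegree K Q.A Q.A' i)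
    (hg : g ∈ cochainDegree K Q.A Q.A' j) :
    Q.l₂ f g ∈ cochainDegree K Q.A Q.A' (i + j + 1) := by
  rw [show i + j + 1 = 1 + i + j by ring]
  exact Q.proj_mem_cochainDegree (isGradedLieBracket_gerstenhaberBracket.mem
    (isGradedLieBracket_gerstenhaberBracket.mem (bilinCochain_mem _)
      (Q.lift_mem_cochainDegree hf)) (Q.lift_mem_cochainDegree hg))

theorem l₂_symm {i j : ℤ} {f g : Cochains K Q.A Q.A'} (hf : f ∈ cochainDegree K Q.A Q.A' i)
    (hg : g ∈ cochainDegree K Q.A Q.A' j) : Q.l₂ f g = (i * j).negOnePow • Q.l₂ g f := by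
  apply Q.lift_injective
  rw [Units.smul_def, map_zsmul, ← Units.smul_def, lift_l₂, lift_l₂]
  exact isGradedLieBracket_gerstenhaberBracket.derived_symm (bilinCochain_mem _)
    (Q.lift_mem_cochainDegree hf) (Q.lift_mem_cochainDegree hg) (Q.bracket_lift_lift f g)

end QuasiTwilled

section BilinLin

variable {K V : Type*} [Field K] [AddCommGroup V] [Module K V]

theorem gerstenhaberBracket_bilin_lin_eq (B : V →ₗ[K] V →ₗ[K] V) (E : V →ₗ[K] V) :
    gerstenhaberBracket (bilinCochain B) (linCochain E) =
      bilinCochain (B.comp E + B.compl₂ E - B.compr₂ E) := by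
  rw [← sub_eq_zero]
  apply eq_bilinCochain_of_mem
  · exact Submodule.sub_mem _ (isGradedLieBracket_gerstenhaberBracket.mem (j := 0)
      (bilinCochain_mem _) (linCochain_mem _)) (bilinCochain_mem _)
  · intro x
    rw [map_sub, gerstenhaberBracket_bilin_lin, evalSeq_one_bilinCochain]
    simp

end BilinLin

/-! ### The deformation equation as a curved Maurer–Cartan equation, and the twisted operations. -/

namespace QuasiTwilled

variable {K 𝒜 : Type*} [Field K] [NonUnitalRing 𝒜] [Module K 𝒜]
  [SMulCommClass K 𝒜 𝒜] [IsScalarTower K 𝒜 𝒜] (Q : QuasiTwilled K 𝒜)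

theorem pr_coe (x : Q.A) : Q.pr x = x := Q.pr_of_mem x.2
theorem pr_coe' (u : Q.A') : Q.pr u = 0 := Q.pr_of_mem' u.2
theorem pr'_coe' (u : Q.A') : Q.pr' u = u := Q.pr'_of_mem' u.2
theorem pr'_coe (x : Q.A) : Q.pr' x = 0 := Q.pr'_of_mem x.2

theorem lift_units_smul (ε : ℤˣ) (F : Cochains K Q.A Q.A') : Q.lift (ε • F) = ε • Q.lift F := by
  rw [Units.smul_def, map_zsmul, ← Units.smul_def]

theorem lift_linCochain (E : Q.A →ₗ[K] Q.A') :
    Q.lift (linCochain E) = linCochain (Q.A'.subtype.comp (E.comp Q.pr)) := by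
  refine cochains_ext_seq fun n x => ?_
  rw [lift_apply, linCochain, linCochain, evalSeq_cochainOf, evalSeq_cochainOf]
  split_ifs <;> rfl

theorem evalSeq_l₁_linCochain (E : Q.A →ₗ[K] Q.A') (x : ℕ → Q.A) :
    evalSeq 1 x (Q.l₁ (linCochain E)) =
      Q.ρ (x 0) (E (x 1)) + Q.μ (E (x 0)) (x 1) - E (Q.π (x 0) (x 1)) := by
  rw [l₁, LinearMap.comp_apply, LinearMap.comp_apply, proj_apply,
    lift_linCochain, gerstenhaberBracket_bilin_lin]
  simp [liftπρμ, pr_coe, pr_coe', pr'_coe, pr'_coe']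
  abel

theorem evalSeq_l₂_linCochain (E : Q.A →ₗ[K] Q.A') (x : ℕ → Q.A) :
    evalSeq 1 x (Q.l₂ (linCochain E) (linCochain E)) =
      (2 : K) • (Q.β (E (x 0)) (E (x 1)) -
        E (Q.ξ (x 0) (E (x 1)) + Q.η (E (x 0)) (x 1))) := by
  rw [l₂, LinearMap.compr₂_apply, LinearMap.compl₁₂_apply, LinearMap.comp_apply, proj_apply,
    lift_linCochain, gerstenhaberBracket_bilin_lin_eq,
    gerstenhaberBracket_bilin_lin]
  simp [liftξηβ, pr_coe, pr_coe', pr'_coe, pr'_coe']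
  module

/-- Right deformation maps are the Maurer-Cartan elements of the curved structure. -/
theorem isRightDeformationMap_iff (hK : (2 : K) ≠ 0) (E : Q.A →ₗ[K] Q.A') :
    Q.IsRightDeformationMap E ↔
      Q.l₀ + Q.l₁ (linCochain E) + (2 : K)⁻¹ • Q.l₂ (linCochain E) (linCochain E) = 0 := by
  have key : ∀ x : ℕ → Q.A, evalSeq 1 x
      (Q.l₀ + Q.l₁ (linCochain E) + (2 : K)⁻¹ • Q.l₂ (linCochain E) (linCochain E)) =
      (Q.ρ (x 0) (E (x 1)) + Q.μ (E (x 0)) (x 1) + Q.β (E (x 0)) (E (x 1)) + Q.θ (x 0) (x 1)) -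
      E (Q.π (x 0) (x 1) + Q.ξ (x 0) (E (x 1)) + Q.η (E (x 0)) (x 1)) := fun x => by
    rw [map_add, map_add, map_smul, evalSeq_l₂_linCochain, evalSeq_l₁_linCochain, l₀,
      evalSeq_one_bilinCochain, smul_smul, inv_mul_cancel₀ hK]
    simp only [map_add]
    module
  constructor
  · intro h
    apply eq_bilinCochain_of_mem
    · refine Submodule.add_mem _ (Submodule.add_mem _ (bilinCochain_mem _) ?_)
        (Submodule.smul_mem _ _ ?_)
      · exact Q.l₁_mem (linCochain_mem E)
      · exact Q.l₂_mem (linCochain_mem E) (linCochain_mem E)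
    · intro x
      rw [key, h, sub_self]
  · intro h x y
    have := key (fun n => if n = 0 then x else y)
    rw [h, map_zero] at this
    exact (sub_eq_zero.mp this.symm).symm

theorem l_of_three_le {k : ℕ} (hk : 3 ≤ k) : Q.l k = 0 := by
  obtain ⟨k, rfl⟩ := Nat.exists_eq_add_of_le' hk
  rfl

theorem twisted_one (D : Q.A →ₗ[K] Q.A') (x : Fin 1 → Cochains K Q.A Q.A') :
    Q.twisted D 1 x = Q.l₁ (x 0) + Q.l₂ (linCochain D) (x 0) := by
  change (∑ᶠ n : ℕ, ((n.factorial : K)⁻¹) •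
      ((Q.l (n + (0 + 1))).domDomCongr finSumFinEquiv.symm).currySum
        (fun _ : Fin n => linCochain D)) x = _
  -- Only `n = 0` and `n = 1` contribute, because `l (n + 1)` vanishes from `n = 2` on.
  rw [finsum_eq_sum_of_support_subset (s := Finset.range 2)]
  · simp [Finset.sum_range_succ]
    rfl
  · intro n hn
    by_contra h
    refine hn ?_
    dsimp only
    rw [Q.l_of_three_le (by simp at h; omega)]
    exact smul_zero _

theorem twisted_two (D : Q.A →ₗ[K] Q.A') (x : Fin 2 → Cochains K Q.A Q.A') :
    Q.twisted D 2 x = Q.l₂ (x 0) (x 1) := by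
  change (∑ᶠ n : ℕ, ((n.factorial : K)⁻¹) •
      ((Q.l (n + (1 + 1))).domDomCongr finSumFinEquiv.symm).currySum
        (fun _ : Fin n => linCochain D)) x = _
  rw [finsum_eq_sum_of_support_subset (s := Finset.range 1)]
  · simp
    rfl
  · intro n hn
    by_contra h
    refine hn ?_
    dsimp only
    rw [Q.l_of_three_le (by simp at h; omega)]
    exact smul_zero _

theorem twisted_of_three_le (D : Q.A →ₗ[K] Q.A') {k : ℕ} (hk : 3 ≤ k) : Q.twisted D k = 0 := by
  obtain ⟨k, rfl⟩ := Nat.exists_eq_add_of_le' hk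
  change (∑ᶠ n : ℕ, ((n.factorial : K)⁻¹) •
      ((Q.l (n + (k + 2 + 1))).domDomCongr finSumFinEquiv.symm).currySum
        (fun _ : Fin n => linCochain D)) = _
  refine (finsum_congr fun n => ?_).trans finsum_zero
  rw [Q.l_of_three_le (by omega)]
  exact smul_zero _

theorem twisted_zero (D : Q.A →ₗ[K] Q.A') : Q.twisted D 0 = 0 := rfl

/-! ### The twisted differential as a bracket with an element of square zero. -/

section

variable (D : Q.A →ₗ[K] Q.A')

/-- The element `π + ρ + μ + [ξ + η + β, D]_G`, whose adjoint action is the twisted differential. -/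
def twistedProduct : Cochains K 𝒜 𝒜 :=
  bilinCochain Q.liftπρμ + gerstenhaberBracket (bilinCochain Q.liftξηβ) (Q.lift (linCochain D))

theorem twistedProduct_mem : Q.twistedProduct D ∈ cochainDegree K 𝒜 𝒜 1 :=
  Submodule.add_mem _ (bilinCochain_mem _) (isGradedLieBracket_gerstenhaberBracket.mem (j := 0)
    (bilinCochain_mem _) (Q.lift_mem_cochainDegree (linCochain_mem D)))

/-- The twisted differential `f ↦ l₁(f) + l₂(D, f)`. -/
def twistedDifferential : Cochains K Q.A Q.A' →ₗ[K] Cochains K Q.A Q.A' :=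
  Q.l₁ + Q.l₂ (linCochain D)

theorem lift_twistedDifferential (f : Cochains K Q.A Q.A') :
    Q.lift (Q.twistedDifferential D f) =
      gerstenhaberBracket (Q.twistedProduct D) (Q.lift f) := by
  rw [twistedDifferential, LinearMap.add_apply, map_add, lift_l₁, lift_l₂, twistedProduct, map_add,
    LinearMap.add_apply]

theorem twistedDifferential_mem {i : ℤ} {f : Cochains K Q.A Q.A'}
    (hf : f ∈ cochainDegree K Q.A Q.A' i) :
    Q.twistedDifferential D f ∈ cochainDegree K Q.A Q.A' (i + 1) := by
  refine Submodule.add_mem _ (Q.l₁_mem hf) ?_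
  simpa using Q.l₂_mem (linCochain_mem D) hf

theorem twistedProduct_bracket (hK : (2 : K) ≠ 0) :
    gerstenhaberBracket (Q.twistedProduct D) (bilinCochain Q.liftξηβ) = 0 := by
  obtain ⟨hqq, hpq, -⟩ := Q.bracket_relations hK
  have hb := isGradedLieBracket_gerstenhaberBracket (K := K) (V := 𝒜)
  have dq : bilinCochain Q.liftξηβ ∈ cochainDegree K 𝒜 𝒜 1 := bilinCochain_mem _
  have dd := Q.lift_mem_cochainDegree (linCochain_mem D)
  rw [twistedProduct, map_add, LinearMap.add_apply, hpq, zero_add,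
    hb.symm_of_degree_one (hb.mem (j := 0) dq dd) dq]
  exact hb.square_zero hK dq hqq dd

/-- With e = [q,D], bracketing the equation of `D` with q and using Jacobi gives [q,t] - [p,e] -
½[e,e] = 0. Combined with [p,p] + 2[q,t] = 0, this is [p,p] + 2[p,e] + [e,e] = 0. -/
theorem twistedProduct_self (hK : (2 : K) ≠ 0) (hD : Q.IsRightDeformationMap D) :
    gerstenhaberBracket (Q.twistedProduct D) (Q.twistedProduct D) = 0 := by
  obtain ⟨hqq, hpq, hpp⟩ := Q.bracket_relations hK
  have hb := isGradedLieBracket_gerstenhaberBracket (K := K) (V := 𝒜)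
  have dp : bilinCochain Q.liftπρμ ∈ cochainDegree K 𝒜 𝒜 1 := bilinCochain_mem _
  have dq : bilinCochain Q.liftξηβ ∈ cochainDegree K 𝒜 𝒜 1 := bilinCochain_mem _
  have dd := Q.lift_mem_cochainDegree (linCochain_mem D)
  have hc := congrArg Q.lift ((Q.isRightDeformationMap_iff hK D).mp hD)
  rw [map_add, map_add, map_smul, map_zero, lift_l₁, lift_l₂] at hc
  rw [twistedProduct]
  generalize bilinCochain Q.liftπρμ = p at *
  generalize bilinCochain Q.liftξηβ = q at *
  generalize Q.lift Q.l₀ = t at *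
  generalize Q.lift (linCochain D) = d at *
  have de : gerstenhaberBracket q d ∈ cochainDegree K 𝒜 𝒜 1 := hb.mem (j := 0) dq dd
  have hc' := congrArg (gerstenhaberBracket q) hc
  have h1 := hb.jacobi dq dp dd
  have h2 := hb.jacobi dq de dd
  have h3 := hb.symm_of_degree_one de dp
  rw [hb.symm_of_degree_one dq dp, hpq] at h1
  rw [hb.square_zero hK dq hqq dd] at h2
  simp only [map_add, map_smul, map_zero, LinearMap.zero_apply, LinearMap.add_apply, mul_one,
    Int.negOnePow_one, Units.neg_smul, one_smul, zero_add, h3] at hc' h1 h2 ⊢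
  rw [h1, h2] at hc'
  have h4 : (2 : K) * 2⁻¹ = 1 := mul_inv_cancel₀ hK
  have hc2 := congrArg (fun z => (2 : K) • z) hc'
  simp only [smul_add, smul_smul, h4, smul_neg, smul_zero] at hc2
  linear_combination (norm := module) (1 : K) • hpp - (1 : K) • hc2

theorem twistedDifferential_square (hK : (2 : K) ≠ 0) (hD : Q.IsRightDeformationMap D) {i : ℤ}
    {x : Cochains K Q.A Q.A'} (hx : x ∈ cochainDegree K Q.A Q.A' i) :
    Q.twistedDifferential D (Q.twistedDifferential D x) = 0 := by
  apply Q.lift_injective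
  rw [lift_twistedDifferential, lift_twistedDifferential, map_zero]
  exact isGradedLieBracket_gerstenhaberBracket.square_zero hK (Q.twistedProduct_mem D)
    (Q.twistedProduct_self D hK hD) (Q.lift_mem_cochainDegree hx)

theorem twistedDifferential_leibniz (hK : (2 : K) ≠ 0) {i j : ℤ} {x y : Cochains K Q.A Q.A'}
    (hx : x ∈ cochainDegree K Q.A Q.A' i) (hy : y ∈ cochainDegree K Q.A Q.A' j) :
    Q.twistedDifferential D (Q.l₂ x y) + Q.l₂ (Q.twistedDifferential D x) y +
      (i * j).negOnePow • Q.l₂ (Q.twistedDifferential D y) x = 0 := by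
  apply Q.lift_injective
  have hxy := Q.bracket_lift_lift x (Q.twistedDifferential D y)
  rw [lift_twistedDifferential] at hxy
  rw [map_add, map_add, lift_units_smul, map_zero]
  simp only [lift_l₂, lift_twistedDifferential]
  exact isGradedLieBracket_gerstenhaberBracket.derived_leibniz (Q.twistedProduct_mem D)
    (bilinCochain_mem _) (Q.twistedProduct_bracket D hK) (Q.lift_mem_cochainDegree hx)
    (Q.lift_mem_cochainDegree hy) hxy

end

theorem l₂_jacobi (hK : (2 : K) ≠ 0) {i j k : ℤ} {x y z : Cochains K Q.A Q.A'}
    (hx : x ∈ cochainDegree K Q.A Q.A' i) (hy : y ∈ cochainDegree K Q.A Q.A' j)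
    (hz : z ∈ cochainDegree K Q.A Q.A' k) :
    Q.l₂ (Q.l₂ x y) z + (j * k).negOnePow • Q.l₂ (Q.l₂ x z) y +
      (i * (j + k)).negOnePow • Q.l₂ (Q.l₂ y z) x = 0 := by
  apply Q.lift_injective
  have hxz := Q.bracket_lift_lift x (Q.l₂ y z)
  have hyz := Q.bracket_lift_lift y (Q.l₂ x z)
  rw [lift_l₂] at hxz hyz
  rw [map_add, map_add, lift_units_smul, lift_units_smul, map_zero]
  simp only [lift_l₂]
  exact isGradedLieBracket_gerstenhaberBracket.derived_jacobi hK (bilinCochain_mem _)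
    (Q.bracket_relations hK).1 (Q.lift_mem_cochainDegree hx)
    (Q.lift_mem_cochainDegree hy) (Q.lift_mem_cochainDegree hz) hxz hyz

end QuasiTwilled

/-! ### Koszul signs, shuffles, and reduction to identities in at most three arguments. -/

section LInfinityCriterion

theorem koszulSign_one {n : ℕ} (d : Fin n → ℤ) : koszulSign d 1 = 1 := by
  rw [koszulSign, Finset.filter_false_of_mem, Finset.prod_empty]
  rintro p - ⟨h, h'⟩
  exact absurd h (not_lt.mpr h'.le)

theorem koszulSign_swap_two (d : Fin 2 → ℤ) :
    koszulSign d (Equiv.swap 0 1) = (d 1 * d 0).negOnePow := by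
  rw [koszulSign, show Finset.univ.filter (fun p : Fin 2 × Fin 2 => p.1 < p.2 ∧
    Equiv.swap (0 : Fin 2) 1 p.2 < Equiv.swap (0 : Fin 2) 1 p.1) = {(0, 1)} by decide,
    Finset.prod_singleton]
  rfl

theorem koszulSign_swap_three (d : Fin 3 → ℤ) :
    koszulSign d (Equiv.swap 1 2) = (d 2 * d 1).negOnePow := by
  rw [koszulSign, show Finset.univ.filter (fun p : Fin 3 × Fin 3 => p.1 < p.2 ∧
    Equiv.swap (1 : Fin 3) 2 p.2 < Equiv.swap (1 : Fin 3) 2 p.1) = {(1, 2)} by decide,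
    Finset.prod_singleton]
  rfl

theorem koszulSign_rotate_three (d : Fin 3 → ℤ) :
    koszulSign d (finRotate 3) = (d 1 * d 0).negOnePow * (d 2 * d 0).negOnePow := by
  rw [koszulSign, show Finset.univ.filter (fun p : Fin 3 × Fin 3 => p.1 < p.2 ∧
    finRotate 3 p.2 < finRotate 3 p.1) = {(0, 2), (1, 2)} by decide,
    Finset.prod_pair (by decide)]
  rfl

/-- The decidability instance is left arbitrary so that the classical one in the Jacobi identity
matches, while the explicit shuffle lists are found by `decide`. -/
theorem filter_isShuffle_eq {n i : ℕ} {_ : DecidablePred fun σ : Equiv.Perm (Fin n) => IsShuffle i σ}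
    {s : Finset (Equiv.Perm (Fin n))} (h : ∀ σ, IsShuffle i σ ↔ σ ∈ s) :
    Finset.univ.filter (fun σ => IsShuffle i σ) = s := by
  ext σ
  simp [h]

theorem isShuffle_two_one (σ : Equiv.Perm (Fin 2)) :
    IsShuffle 1 σ ↔ σ ∈ ({1, Equiv.swap 0 1} : Finset (Equiv.Perm (Fin 2))) := by
  revert σ; unfold IsShuffle; decide

theorem isShuffle_two_two (σ : Equiv.Perm (Fin 2)) :
    IsShuffle 2 σ ↔ σ ∈ ({1} : Finset (Equiv.Perm (Fin 2))) := by
  revert σ; unfold IsShuffle; decide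

theorem isShuffle_three_two (σ : Equiv.Perm (Fin 3)) : IsShuffle 2 σ ↔
    σ ∈ ({1, Equiv.swap 1 2, finRotate 3} : Finset (Equiv.Perm (Fin 3))) := by
  revert σ; unfold IsShuffle; decide

variable {K V : Type*} [Field K] [AddCommGroup V] [Module K V]

/-- A differential and a binary bracket satisfying the generalized Jacobi identities with at most
three arguments define an `L_∞`-algebra. -/
theorem isLInfinityAlgebra_of_binary {𝒢 : ℤ → Submodule K V}
    {l : ∀ k : ℕ, MultilinearMap K (fun _ : Fin k => V) V} {δ : V → V} {m : V → V → V}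
    (h𝒢 : DirectSum.IsInternal 𝒢) (l0 : l 0 = 0) (l1 : ∀ x, l 1 x = δ (x 0))
    (l2 : ∀ x, l 2 x = m (x 0) (x 1)) (l3 : ∀ k, 3 ≤ k → l k = 0)
    (hδ : ∀ i, ∀ x ∈ 𝒢 i, δ x ∈ 𝒢 (i + 1))
    (hm : ∀ i j, ∀ x ∈ 𝒢 i, ∀ y ∈ 𝒢 j, m x y ∈ 𝒢 (i + j + 1))
    (hsymm : ∀ i j, ∀ x ∈ 𝒢 i, ∀ y ∈ 𝒢 j, m x y = (i * j).negOnePow • m y x)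
    (hδδ : ∀ i, ∀ x ∈ 𝒢 i, δ (δ x) = 0)
    (hδm : ∀ i j, ∀ x ∈ 𝒢 i, ∀ y ∈ 𝒢 j,
      δ (m x y) + m (δ x) y + (i * j).negOnePow • m (δ y) x = 0)
    (hmm : ∀ i j k, ∀ x ∈ 𝒢 i, ∀ y ∈ 𝒢 j, ∀ z ∈ 𝒢 k,
      m (m x y) z + (j * k).negOnePow • m (m x z) y +
        (i * (j + k)).negOnePow • m (m y z) x = 0) :
    IsLInfinityAlgebra 𝒢 l where
  isInternal := h𝒢
  l_zero := l0
  degree_one k d x hx := by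
    match k with
    | 0 => rw [l0]; exact zero_mem _
    | 1 => rw [l1, Fin.sum_univ_one]; exact hδ _ _ (hx 0)
    | 2 => rw [l2, Fin.sum_univ_two]; exact hm _ _ _ (hx 0) _ (hx 1)
    | k + 3 => rw [l3 _ (by omega)]; exact zero_mem _
  graded_symm n d x hx σ := by
    match n with
    | 0 => rw [l0]; simp
    | 1 => rw [Subsingleton.elim σ 1, koszulSign_one, one_smul]; rfl
    | 2 =>
      have h : ∀ σ : Equiv.Perm (Fin 2), σ = 1 ∨ σ = Equiv.swap 0 1 := by decide
      rcases h σ with rfl | rfl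
      · rw [koszulSign_one, one_smul]; rfl
      · rw [koszulSign_swap_two, l2, l2]
        exact hsymm _ _ _ (hx 1) _ (hx 0)
    | n + 3 => rw [l3 _ (by omega)]; simp
  jacobi n d x hx := by
    have hin : ∀ {k r : ℕ} (_ : k = 0 ∨ 3 ≤ k) (y : Fin k → V) (z : Fin r → V),
        l (r + 1) (Fin.cons (l k y) z) = 0 := fun {k r} hk y z => by
      have : l k = 0 := by
        rcases hk with rfl | hk
        exacts [l0, l3 k hk]
      rw [this]
      exact (l _).map_coord_zero 0 rfl
    have e12 : ∀ (y : Fin 2 → V) (z : Fin 0 → V), l 1 (Fin.cons (l 2 y) z) = δ (m (y 0) (y 1)) :=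
      fun y z => by rw [l1, Fin.cons_zero, l2]
    have e21 : ∀ (y : Fin 1 → V) (z : Fin 1 → V), l 2 (Fin.cons (l 1 y) z) = m (δ (y 0)) (z 0) :=
      fun y z => by rw [l2, Fin.cons_zero, l1]; rfl
    have e22 : ∀ (y : Fin 2 → V) (z : Fin 1 → V),
        l 2 (Fin.cons (l 2 y) z) = m (m (y 0) (y 1)) (z 0) :=
      fun y z => by rw [l2, Fin.cons_zero, l2]; rfl
    have hh : ∀ {k : ℕ} (_ : 3 ≤ k) (y : Fin k → V), l k y = 0 := fun hk y => by
      rw [l3 _ hk]; rfl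
    match n with
    | 0 =>
      refine Finset.sum_eq_zero fun i _ => Finset.sum_eq_zero fun σ _ => ?_
      rw [hin (Or.inl (by omega)), smul_zero]
    | 1 =>
      rw [Fin.sum_univ_two]
      refine (congrArg₂ (· + ·) (Finset.sum_eq_zero fun σ _ => ?_)
        (Finset.sum_eq_zero fun σ _ => ?_)).trans (add_zero 0)
      · rw [hin (Or.inl (by decide)), smul_zero]
      · have e : l 1 (Fin.cons (l 1 fun a => x (σ a)) fun b : Fin 0 => x (σ ⟨1 + b, by omega⟩)) =
            0 := by
          rw [l1, Fin.cons_zero, l1]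
          exact hδδ _ _ (hx _)
        exact (congrArg (koszulSign d σ • ·) e).trans (smul_zero _)
    | 2 =>
      rw [Fin.sum_univ_three]
      refine (congrArg₂ (· + ·) (congrArg₂ (· + ·) (Finset.sum_eq_zero fun σ _ => ?_)
        (congrArg (fun s => Finset.sum s _) (filter_isShuffle_eq isShuffle_two_one)))
        (congrArg (fun s => Finset.sum s _) (filter_isShuffle_eq isShuffle_two_two))).trans ?_
      · rw [hin (Or.inl (by decide)), smul_zero]
      · rw [Finset.sum_pair (by decide), Finset.sum_singleton, koszulSign_one, koszulSign_swap_two,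
          one_smul, one_smul, zero_add, mul_comm]
        refine (congrArg₂ (· + ·) (congrArg₂ (· + ·) (e21 _ _) (congrArg (_ • ·) (e21 _ _)))
          (e12 _ _)).trans ?_
        exact (add_comm _ _).trans ((add_assoc _ _ _).symm.trans
          (hδm _ _ _ (hx 0) _ (hx 1)))
    | 3 =>
      -- With three arguments only `i = 2` survives: `i = 1` has outer operation `l 3`, and `i = 0`,
      -- `i = 3` have vanishing inner operation.
      rw [Fin.sum_univ_four]
      refine (congrArg₂ (· + ·) (congrArg₂ (· + ·) (congrArg₂ (· + ·)
        (Finset.sum_eq_zero fun σ _ => ?_) (Finset.sum_eq_zero fun σ _ => ?_))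
        (congrArg (fun s => Finset.sum s _) (filter_isShuffle_eq isShuffle_three_two)))
        (Finset.sum_eq_zero fun σ _ => ?_)).trans ?_
      · rw [hin (Or.inl (by decide)), smul_zero]
      · rw [hh (by decide), smul_zero]
      · rw [hin (Or.inr (by decide)), smul_zero]
      · rw [Finset.sum_insert (by decide), Finset.sum_pair (by decide), koszulSign_one,
          koszulSign_swap_three, koszulSign_rotate_three, one_smul, zero_add, add_zero, zero_add,
          ← Int.negOnePow_add, ← add_mul, mul_comm _ (d 0), mul_comm (d 2)]
        refine (congrArg₂ (· + ·) (e22 _ _) (congrArg₂ (· + ·) (congrArg (_ • ·) (e22 _ _))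
          (congrArg (_ • ·) (e22 _ _)))).trans ?_
        exact (add_assoc _ _ _).symm.trans (hmm _ _ _ _ (hx 0) _ (hx 1) _ (hx 2))
    | n + 4 =>
      refine Finset.sum_eq_zero fun i _ => Finset.sum_eq_zero fun σ _ => ?_
      -- With at least four arguments, either the inner or the outer operation has arity at least 3.
      rcases le_or_gt 3 (i : ℕ) with hi | hi
      · rw [hin (Or.inr hi), smul_zero]
      · rw [hh (by omega), smul_zero]

end LInfinityCriterion

end

theorem mainTheorem7 {K 𝒜 : Type*} [Field K] (hK : (2 : K) ≠ 0)
    [NonUnitalRing 𝒜] [Module K 𝒜] [SMulCommClass K 𝒜 𝒜] [IsScalarTower K 𝒜 𝒜]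
    (Q : QuasiTwilled K 𝒜) (D : Q.A →ₗ[K] Q.A') (hD : Q.IsRightDeformationMap D) :
    -- the operations twisted by `D` form an `L_∞`-algebra, with `l₁ᴰ(f) = l₁(f) + l₂(D, f)`,
    -- `l₂ᴰ = l₂` and `l_kᴰ = 0` for `k ≥ 3`
    IsLInfinityAlgebra (cochainDegree K Q.A Q.A') (Q.twisted D) ∧
    (∀ f, Q.twisted D 1 ![f] = Q.l₁ f + Q.l₂ (linCochain D) f) ∧
    (∀ f g, Q.twisted D 2 ![f, g] = Q.l₂ f g) ∧
    (∀ k, 3 ≤ k → Q.twisted D k = 0) ∧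
    -- its Maurer–Cartan elements are the `D'` for which `D + D'` is a right deformation map
    ∀ D' : Q.A →ₗ[K] Q.A',
      Q.IsRightDeformationMap (D + D') ↔
        IsMaurerCartan (cochainDegree K Q.A Q.A') (Q.twisted D) (linCochain D') := by
  refine ⟨?_, fun f => Q.twisted_one D _, fun f g => Q.twisted_two D _,
    fun k hk => Q.twisted_of_three_le D hk, fun D' => ?_⟩
  · exact isLInfinityAlgebra_of_binary (δ := Q.twistedDifferential D) (m := fun f g => Q.l₂ f g)
      isInternal_cochainDegree (Q.twisted_zero D) (Q.twisted_one D) (Q.twisted_two D)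
      (fun k hk => Q.twisted_of_three_le D hk) (fun i x hx => Q.twistedDifferential_mem D hx)
      (fun i j x hx y hy => Q.l₂_mem hx hy) (fun i j x hx y hy => Q.l₂_symm hx hy)
      (fun i x hx => Q.twistedDifferential_square D hK hD hx)
      (fun i j x hx y hy => Q.twistedDifferential_leibniz D hK hx hy)
      (fun i j k x hx y hy z hz => Q.l₂_jacobi hK hx hy hz)
  · rw [Q.isRightDeformationMap_iff hK]
    have hc := (Q.isRightDeformationMap_iff hK D).mp hD
    -- In degree 0 the Koszul sign is trivial, so the two cross terms agree and absorb the factor ½.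
    have hs : Q.l₂ (linCochain D') (linCochain D) = Q.l₂ (linCochain D) (linCochain D') := by
      simpa using Q.l₂_symm (linCochain_mem D') (linCochain_mem D)
    have hsupp : ∀ k ∉ Finset.range 3, Q.twisted D k (fun _ => linCochain D') = 0 := fun k hk => by
      rw [Q.twisted_of_three_le D (by simpa using hk)]; rfl
    have hsum : ∑ᶠ k : ℕ, ((k.factorial : K)⁻¹) • Q.twisted D k (fun _ => linCochain D') =
        Q.l₁ (linCochain D') + Q.l₂ (linCochain D) (linCochain D') +
          (2 : K)⁻¹ • Q.l₂ (linCochain D') (linCochain D') := by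
      rw [finsum_eq_sum_of_support_subset (s := Finset.range 3)]
      · rw [Finset.sum_range_succ, Finset.sum_range_succ, Finset.sum_range_one, Q.twisted_zero,
          Q.twisted_one, Q.twisted_two]
        simp
      · intro k hk
        by_contra h
        exact hk (by dsimp only; rw [hsupp k h, smul_zero])
    have hfin : {k : ℕ | Q.twisted D k (fun _ => linCochain D') ≠ 0}.Finite :=
      (Finset.range 3).finite_toSet.subset fun k hk => by
        by_contra h
        exact hk (hsupp k h)
    have h4 : (2 : K)⁻¹ * 2 = 1 := inv_mul_cancel₀ hK
    have hsplit : Q.l₀ + Q.l₁ (linCochain (D + D')) +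
        (2 : K)⁻¹ • Q.l₂ (linCochain (D + D')) (linCochain (D + D')) =
        Q.l₁ (linCochain D') + Q.l₂ (linCochain D) (linCochain D') +
          (2 : K)⁻¹ • Q.l₂ (linCochain D') (linCochain D') := by
      have h5 : (2 : K)⁻¹ • (2 : K) • Q.l₂ (linCochain D) (linCochain D') =
        Q.l₂ (linCochain D) (linCochain D') := by rw [smul_smul, h4, one_smul]
      rw [linCochain_add, map_add, map_add, map_add, LinearMap.add_apply, LinearMap.add_apply, hs]
      -- `hc` cancels every term involving `D` alone, together with the curvature `Q.l₀`.
      linear_combination (norm := module) (1 : K) • hc + (1 : K) • h5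
    rw [hsplit, IsMaurerCartan, hsum]
    exact ⟨fun h => ⟨linCochain_mem D', hfin, h⟩, fun h => h.2.2⟩
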